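/- Let $(\mathcal X,d)$ be a complete separable metric space, $[K]=\{1,\dots,K\}$, $S_K$ the set of nonempty subsets of $[K]$, and $\mu_1,\dots,\mu_K$ finite nonnegative Borel measures on $\mathcal X$. Let $c:\mathcal X\times\mathcal X\to[0,\infty]$ be lower semicontinuous with $c(x,x)=0$ for all $x$, and such that, whenever $(x_n)$ is bounded and $\sup_n c(x_n',x_n)<\infty$, the set $\{(x_n',x_n):n\in\mathbb N\}$ is relatively compact in $\mathcal X\times\mathcal X$. For measures $\rho,\nu$ on $\mathcal X$ put $C(\rho,\nu)=\inf_\pi\int c(x',x)\,d\pi(x',x)$, the infimum over couplings $\pi$ with first marginal $\rho$ and second marginal $\nu$ ($=\infty$ if there are none). An *optimal generalized barycenter* is a finite measure $\lambda$ for which there are $\widetilde\mu_1,\dots,\widetilde\mu_K$ such that $(\lambda,\widetilde\mu_1,\dots,\widetilde\mu_K)$ minimizes $$\lambda(\mathcal X)+\sum_{i\in[K]}C(\widetilde\mu_i,\mu_i)\quad\text{subject to }\widetilde\mu_i\le\lambda\text{ for all }i .\tag{1}$$ The *stratified problem* is to minimize, over finite measures $\lambda_A$ and measures $\mu_{i,A}$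 ($A\in S_K$, $i\in A$), $$\sum_{A\in S_K}\Big\{\lambda_A(\mathcal X)+\sum_{i\in A}C(\lambda_A,\mu_{i,A})\Big\}\quad\text{subject to }\sum_{A\in S_K:\,i\in A}\mu_{i,A}=\mu_i\text{ for all }i .\tag{2}$$ For $A\in S_K$ and $x=(x_1,\dots,x_K)\in\mathcal X^K$ let $T_A(x)=\operatorname{argmin}_{y\in\mathcal X}\sum_{i\in A}c(y,x_i)$, with $T_A(x)=\emptyset$ if this sum is $+\infty$ for every $y$. Let $D_A$ be the set of $x\in\mathcal X^K$ with $x_i\in\operatorname{spt}(\mu_i)$ for every $i$ such that $i\in A$ or $\mu_i\neq0$ (so $D_A=\prod_i\operatorname{spt}(\mu_i)$ if no $\mu_i$ vanishes). Put $T_A=\bigcup_{x\in D_A}T_A(x)$ and $T=\bigcup_{A\in S_K}T_A$. A measure $\nu$ is *concentrated on* $S$ if $\mathcal X\setminus S$ is $\nu$-null (for a finite $\nu$ and a $\nu$-measurable $S$: $\nu(S)=\nu(\mathcal X)$). Then: 1. An optimal generalized barycenter exists, and for each optimal generalized barycenter $\lambda$ there is a solution $(\lambda_A,\mu_{i,A})$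 of (2) with $\sum_{A\in S_K}\lambda_A=\lambda$. 2. If $\lambda$ is an optimal generalized barycenter and $(\lambda_A,\mu_{i,A})$ is a solution of (2) with $\sum_{A\in S_K}\lambda_A=\lambda$, then each $\lambda_A$ is concentrated on $T_A$, $\lambda$ is concentrated on $T$, and, for every solution $(\lambda,\widetilde\mu_1,\dots,\widetilde\mu_K)$ of (1) with this $\lambda$, each $\widetilde\mu_i$ is concentrated on $T$. 3. Let $f_A:\mathcal X^K\to\mathcal X$, $A\in S_K$, be Borel maps with $f_A(x)\in T_A(x)$ for all $x\in D_A$ with $T_A(x)\ne\emptyset$. Then there is an optimal generalized barycenter concentrated on $F=\bigcup_{A\in S_K}\{f_A(x):x\in D_A,\ T_A(x)\neq\emptyset\}$. 4. If each $\mu_i$ is concentrated on a finite set of $n_i$ points, then there is an optimal generalized barycenter concentrated on a finite set of at most $\sum_{A\in S_K}\prod_{i\in A}n_i$ points; and if all $n_i\ge1$, then $\sum_{A\in S_K}\prod_{i\in A}n_i\le 2^K\prod_{i=1}^K n_i$. -/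

import Mathlib

open MeasureTheory Set
open scoped ENNReal

namespace GenBary

/-- Standing assumption on the cost. The first argument of `c` is the perturbed point, the second
one is the data point. -/
structure IsAdmissibleCost {X : Type*} [MetricSpace X] (c : X → X → ℝ≥0∞) : Prop where
  lsc : LowerSemicontinuous (fun p : X × X => c p.1 p.2)
  self_eq_zero : ∀ x, c x x = 0
  coercive : ∀ x' x : ℕ → X, Bornology.IsBounded (range x) → (⨆ n, c (x' n) (x n)) < ⊤ →
    IsCompact (closure (range fun n => (x' n, x n)))

/-- `S_K`: the nonempty subsets of the set of labels. -/
def labelSets (K : ℕ) : Finset (Finset (Fin K)) :=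
  Finset.univ.filter fun A => A.Nonempty

/-- The measure `ν` is concentrated on the (possibly non-Borel) set `S`. For a `ν`-measurable set
`S` and finite `ν` this is `ν S = ν univ`; in general it is stronger. -/
def ConcentratedOn {X : Type*} [MeasurableSpace X] (ν : Measure X) (S : Set X) : Prop :=
  ν Sᶜ = 0

section Problems

variable {X : Type*} [MeasurableSpace X] {K : ℕ}

/-- The optimal transport cost between `ρ` and `ν`: infimum over couplings with first marginal `ρ`
and second marginal `ν` (it is `⊤` if there is no coupling). -/
noncomputable def transportCost (c : X → X → ℝ≥0∞) (ρ ν : Measure X) : ℝ≥0∞ :=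
  ⨅ (π : Measure (X × X)) (_ : π.fst = ρ) (_ : π.snd = ν), ∫⁻ p, c p.1 p.2 ∂π

/-- Objective of the generalized barycenter problem. -/
noncomputable def baryObjective (c : X → X → ℝ≥0∞) (μ : Fin K → Measure X)
    (lam : Measure X) (μt : Fin K → Measure X) : ℝ≥0∞ :=
  lam univ + ∑ i, transportCost c (μt i) (μ i)

/-- Feasible points of the generalized barycenter problem. -/
def BaryFeasible (lam : Measure X) (μt : Fin K → Measure X) : Prop :=
  IsFiniteMeasure lam ∧ ∀ i, μt i ≤ lam

/-- `(lam, μt)` solves the generalized barycenter problem with data `μ`. -/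
def IsBarySolution (c : X → X → ℝ≥0∞) (μ : Fin K → Measure X)
    (lam : Measure X) (μt : Fin K → Measure X) : Prop :=
  BaryFeasible lam μt ∧ ∀ (lam' : Measure X) (μt' : Fin K → Measure X),
    BaryFeasible lam' μt' → baryObjective c μ lam μt ≤ baryObjective c μ lam' μt'

/-- `lam` is an optimal generalized barycenter of `μ`. -/
def IsOptimalBarycenter (c : X → X → ℝ≥0∞) (μ : Fin K → Measure X) (lam : Measure X) : Prop :=
  ∃ μt : Fin K → Measure X, IsBarySolution c μ lam μt

/-- Objective of the stratified barycenter problem; only the values `lamA A` with `A` nonempty and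
`μA i A` with `i ∈ A` play a role. -/
noncomputable def stratObjective (c : X → X → ℝ≥0∞)
    (lamA : Finset (Fin K) → Measure X) (μA : Fin K → Finset (Fin K) → Measure X) : ℝ≥0∞ :=
  ∑ A ∈ labelSets K, (lamA A univ + ∑ i ∈ A, transportCost c (lamA A) (μA i A))

/-- Feasible points of the stratified barycenter problem. -/
def StratFeasible (μ : Fin K → Measure X)
    (lamA : Finset (Fin K) → Measure X) (μA : Fin K → Finset (Fin K) → Measure X) : Prop :=
  (∀ A ∈ labelSets K, IsFiniteMeasure (lamA A)) ∧
    ∀ i, ∑ A ∈ (labelSets K).filter (fun A => i ∈ A), μA i A = μ i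

/-- `(lamA, μA)` solves the stratified barycenter problem with data `μ`. -/
def IsStratSolution (c : X → X → ℝ≥0∞) (μ : Fin K → Measure X)
    (lamA : Finset (Fin K) → Measure X) (μA : Fin K → Finset (Fin K) → Measure X) : Prop :=
  StratFeasible μ lamA μA ∧
    ∀ (lamA' : Finset (Fin K) → Measure X) (μA' : Fin K → Finset (Fin K) → Measure X),
      StratFeasible μ lamA' μA' → stratObjective c lamA μA ≤ stratObjective c lamA' μA'

end Problems

section Points

variable {X : Type*} {K : ℕ}

/-- `T_A(x₁,…,x_K)`: the minimizers of `y ↦ ∑ i ∈ A, c y (x i)`; it is empty if this function is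
identically `⊤`. -/
def baryPoints (c : X → X → ℝ≥0∞) (A : Finset (Fin K)) (x : Fin K → X) : Set X :=
  {y | ∑ i ∈ A, c y (x i) ≠ ⊤ ∧ ∀ z, ∑ i ∈ A, c y (x i) ≤ ∑ i ∈ A, c z (x i)}

/-- Tuples of points of the supports. If no `μ i` vanishes, this is the product of all the supports.
If `i ∉ A` and `μ i = 0`, the coordinate `x i`, on which `T_A` does not depend, is left free. -/
def supportTuples [TopologicalSpace X] [MeasurableSpace X] (μ : Fin K → Measure X)
    (A : Finset (Fin K)) : Set (Fin K → X) :=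
  {x | ∀ i, i ∈ A ∨ μ i ≠ 0 → x i ∈ (μ i).support}

/-- The set `T_A`. -/
def baryPointSet [TopologicalSpace X] [MeasurableSpace X] (c : X → X → ℝ≥0∞)
    (μ : Fin K → Measure X) (A : Finset (Fin K)) : Set X :=
  ⋃ x ∈ supportTuples μ A, baryPoints c A x

/-- The set `T`, the union of the `T_A` over the nonempty `A`. -/
def allBaryPoints [TopologicalSpace X] [MeasurableSpace X] (c : X → X → ℝ≥0∞)
    (μ : Fin K → Measure X) : Set X :=
  ⋃ A ∈ labelSets K, baryPointSet c μ A

/-- `f` is a (Borel) selection: `f A x ∈ T_A(x)` whenever `T_A(x)` is nonempty. -/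
def IsBarySelection [TopologicalSpace X] [MeasurableSpace X] (c : X → X → ℝ≥0∞)
    (μ : Fin K → Measure X) (f : Finset (Fin K) → (Fin K → X) → X) : Prop :=
  ∀ A ∈ labelSets K, Measurable (f A) ∧
    ∀ x ∈ supportTuples μ A, (baryPoints c A x).Nonempty → f A x ∈ baryPoints c A x

/-- The set `F` of the selected barycenter points. -/
def selectedPoints [TopologicalSpace X] [MeasurableSpace X] (c : X → X → ℝ≥0∞)
    (μ : Fin K → Measure X) (f : Finset (Fin K) → (Fin K → X) → X) : Set X :=
  ⋃ A ∈ labelSets K, f A '' {x ∈ supportTuples μ A | (baryPoints c A x).Nonempty}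

end Points

end GenBary

/-! Existence is the direct method: one minimizes jointly over `lam` and the couplings. Coercivity
of `c` makes couplings of bounded cost tight (`exists_tight`), the constraints are weakly closed,
and the cost is weakly lower semicontinuous.

Problems (1) and (2) have the same value. From (2) to (1) one adds up the strata. From (1) to (2)
(`exists_stratification`), let `h i` be the density of `μt i` with respect to `lam` and include each
label `i` at the point `y` independently with probability `h i y`; the stratum `A` receives the part
of `lam` on which the chosen set is `A`. The mass assigned to the empty set pays for nothing, so
optimality makes it vanish.

Inside a stratum, optimal couplings of `lamA A` with the `μA i A` are glued along their common first
marginal into one measure on pairs `(y, x)` (`exists_multicoupling`), whose cost is the integral of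
`∑ i ∈ A, c y (x i)`. Moving `y` to a measurably selected minimizer `f A x` keeps the mass and the
marginals `μA i A` and cannot raise the cost (`exists_replacement`). By optimality nothing is
gained: `y` was almost surely a minimizer already, and the moved strata are optimal too.
Concentration then follows by projecting to the first coordinate (`ConcentratedOn.image_fst`), and
finite supports by a selection with finitely many values. -/

namespace GenBary
open Filter Topology
open scoped NNReal BoundedContinuousFunction

/-! ### Weak lower semicontinuity of integrals of lower semicontinuous functions -/

section Semicontinuity

/-- The Lipschitz regularization (inf-convolution with `n * edist`) of the truncation `min f n`. -/
noncomputable def lipReg {Z : Type*} [PseudoEMetricSpace Z] (f : Z → ℝ≥0∞) (n : ℕ) (z : Z) : ℝ≥0∞ :=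
  ⨅ w, (min (f w) n + n * edist z w)

variable {Z : Type*} [PseudoEMetricSpace Z] {f : Z → ℝ≥0∞}

lemma lipReg_le (f : Z → ℝ≥0∞) (n : ℕ) (z : Z) : lipReg f n z ≤ min (f z) n :=
  (iInf_le _ z).trans (by simp)

lemma lipReg_mono (f : Z → ℝ≥0∞) : Monotone (lipReg f) := by
  intro m n hmn z
  have h : (m : ℝ≥0∞) ≤ n := by exact_mod_cast hmn
  exact iInf_mono fun w => by gcongr

lemma continuous_lipReg (f : Z → ℝ≥0∞) (n : ℕ) : Continuous (lipReg f n) := by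
  refine continuous_of_le_add_edist n (by simp) fun x y => ?_
  unfold lipReg
  rw [ENNReal.iInf_add]
  refine iInf_mono fun w => ?_
  rw [add_assoc, ← mul_add]
  gcongr
  rw [add_comm]
  exact edist_triangle _ _ _

/-- For `b < f z`, points `w` within `ε` of `z` have `f w > b` by lower semicontinuity, and for all
other `w` the penalty `n * ε` exceeds `b` once `n` is large. -/
lemma iSup_lipReg (hf : LowerSemicontinuous f) (z : Z) : ⨆ n, lipReg f n z = f z := by
  refine le_antisymm (iSup_le fun n => (lipReg_le f n z).trans (min_le_left _ _)) ?_
  refine le_of_forall_lt fun a ha => ?_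
  obtain ⟨b, hab, hb⟩ := exists_between ha
  refine hab.trans_le ?_
  obtain ⟨ε, hε, hball⟩ := EMetric.mem_nhds_iff.1 (hf z b hb)
  have hbt : b ≠ ⊤ := hb.ne_top
  obtain ⟨n₁, hn₁⟩ := ENNReal.exists_nat_gt hbt
  obtain ⟨n₂, hn₂⟩ := ENNReal.exists_nat_mul_gt hε.ne' hbt
  refine le_iSup_of_le (max n₁ n₂) (le_iInf fun w => ?_)
  by_cases hw : edist w z < ε
  · have h₁ : b < f w := hball hw
    refine le_add_right (le_min h₁.le (hn₁.le.trans ?_))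
    exact_mod_cast le_max_left _ _
  · refine le_add_left (hn₂.le.trans ?_)
    rw [edist_comm]
    gcongr
    · exact le_max_right _ _
    · exact not_lt.1 hw

/-- By monotone convergence the integral is a supremum of integrals of bounded continuous functions,
each of them weakly continuous. -/
lemma lowerSemicontinuous_lintegral [MeasurableSpace Z] [BorelSpace Z]
    (hf : LowerSemicontinuous f) :
    LowerSemicontinuous fun π : FiniteMeasure Z => ∫⁻ z, f z ∂(π : Measure Z) := by
  have key : ∀ π : FiniteMeasure Z, ∫⁻ z, f z ∂(π : Measure Z)
      = ⨆ n, ∫⁻ z, lipReg f n z ∂(π : Measure Z) := fun π => by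
    rw [← lintegral_iSup (fun n => (continuous_lipReg f n).measurable) (lipReg_mono f)]
    simp_rw [iSup_lipReg hf]
  simp_rw [key]
  refine lowerSemicontinuous_iSup fun n => Continuous.lowerSemicontinuous ?_
  have hn : ∀ z, lipReg f n z ≤ n := fun z => (lipReg_le f n z).trans (min_le_right _ _)
  have hn' : ∀ z, lipReg f n z ≠ ⊤ := fun z => ((hn z).trans_lt (by simp)).ne
  let g : Z →ᵇ ℝ≥0 := BoundedContinuousFunction.mkOfBound
    ⟨fun z => (lipReg f n z).toNNReal, by
      rw [continuous_iff_continuousAt]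
      exact fun z => (ENNReal.tendsto_toNNReal (hn' z)).comp (continuous_lipReg f n).continuousAt⟩
    n (fun x y => by
      have hb : ∀ z, ((lipReg f n z).toNNReal : ℝ) ≤ n := fun z => by
        have := ENNReal.toNNReal_mono (by simp) (hn z)
        rw [ENNReal.toNNReal_natCast] at this
        exact_mod_cast this
      simp only [ContinuousMap.coe_mk, NNReal.dist_eq, abs_le]
      constructor <;> linarith [hb x, hb y, ((lipReg f n x).toNNReal).2, ((lipReg f n y).toNNReal).2])
  have hg : ∀ z, lipReg f n z = g z := fun z => (ENNReal.coe_toNNReal (hn' z)).symm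
  simp_rw [hg]
  exact FiniteMeasure.continuous_iff_forall_continuous_lintegral.1 continuous_id g

end Semicontinuity

/-! ### Weak closedness of domination between measures -/

section Order

/-- Indicators of closed sets are limits of bounded continuous functions; inner regularity by closed
sets then reaches all Borel sets. -/
lemma measure_le_of_forall_lintegral_le {Z : Type*} [TopologicalSpace Z] [MeasurableSpace Z]
    [TopologicalSpace.PseudoMetrizableSpace Z] [BorelSpace Z] {ρ ν : Measure Z} [IsFiniteMeasure ρ]
    [IsFiniteMeasure ν] (h : ∀ f : Z →ᵇ ℝ≥0, ∫⁻ z, f z ∂ρ ≤ ∫⁻ z, f z ∂ν) : ρ ≤ ν := by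
  have hF : ∀ F : Set Z, IsClosed F → ρ F ≤ ν F := fun F hF =>
    le_of_tendsto_of_tendsto' (HasOuterApproxClosed.tendsto_lintegral_apprSeq hF ρ)
      (HasOuterApproxClosed.tendsto_lintegral_apprSeq hF ν) fun n => h _
  refine Measure.le_iff.2 fun s hs => ?_
  refine le_of_forall_lt fun a ha => ?_
  obtain ⟨F, hFs, hFc, haF⟩ := hs.exists_lt_isClosed_of_ne_top (measure_ne_top ρ s) ha
  exact haF.trans_le ((hF F hFc).trans (measure_mono hFs))

lemma isClosed_setOf_measure_le {Y Z : Type*} [TopologicalSpace Y] [TopologicalSpace Z]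
    [MeasurableSpace Z] [TopologicalSpace.PseudoMetrizableSpace Z] [BorelSpace Z]
    {F G : Y → FiniteMeasure Z} (hF : Continuous F) (hG : Continuous G) :
    IsClosed {y | (F y : Measure Z) ≤ G y} := by
  have : {y | (F y : Measure Z) ≤ G y} =
      ⋂ f : Z →ᵇ ℝ≥0, {y | ∫⁻ z, f z ∂(F y : Measure Z) ≤ ∫⁻ z, f z ∂(G y : Measure Z)} := by
    ext y
    simp only [mem_ofPred_eq, mem_iInter]
    exact ⟨fun h f => lintegral_mono' h le_rfl, measure_le_of_forall_lintegral_le⟩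
  rw [this]
  exact isClosed_iInter fun f => isClosed_le
    (FiniteMeasure.continuous_iff_forall_continuous_lintegral.1 hF f)
    (FiniteMeasure.continuous_iff_forall_continuous_lintegral.1 hG f)

end Order

lemma map_eq_mk_iff {Y Z : Type*} [MeasurableSpace Y] [MeasurableSpace Z] (π : FiniteMeasure Y)
    (f : Y → Z) {ρ : Measure Z} (h : IsFiniteMeasure ρ) :
    π.map f = ⟨ρ, h⟩ ↔ (π : Measure Y).map f = ρ :=
  ⟨fun e => congrArg Subtype.val e, fun e => Subtype.ext e⟩

/-! ### Compactness from the coercivity of the cost -/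

section Coercivity

variable {X : Type*} [MetricSpace X] {c : X → X → ℝ≥0∞}

lemma IsAdmissibleCost.exists_subseq (hc : IsAdmissibleCost c) {y x : ℕ → X} {R : ℝ≥0∞}
    (hR : R ≠ ⊤) (hx : Bornology.IsBounded (range x)) (h : ∀ n, c (y n) (x n) ≤ R) :
    ∃ a b, ∃ φ : ℕ → ℕ, StrictMono φ ∧ Tendsto (y ∘ φ) atTop (𝓝 a) ∧
      Tendsto (x ∘ φ) atTop (𝓝 b) := by
  obtain ⟨p, -, φ, hφ, hp⟩ := (hc.coercive y x hx ((iSup_le h).trans_lt hR.lt_top)).tendsto_subseq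
    (fun n => subset_closure (mem_range_self n))
  exact ⟨p.1, p.2, φ, hφ, (continuous_fst.tendsto p).comp hp, (continuous_snd.tendsto p).comp hp⟩

lemma IsAdmissibleCost.isCompact_sublevel (hc : IsAdmissibleCost c) {A : Set X} (hA : IsCompact A)
    {R : ℝ≥0∞} (hR : R ≠ ⊤) : IsCompact {p : X × X | p.2 ∈ A ∧ c p.1 p.2 ≤ R} := by
  have hcl : IsClosed {p : X × X | p.2 ∈ A ∧ c p.1 p.2 ≤ R} :=
    (hA.isClosed.preimage continuous_snd).inter (hc.lsc.isClosed_preimage R)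
  refine IsSeqCompact.isCompact fun p hp => ?_
  obtain ⟨a, b, φ, hφ, ha, hb⟩ := hc.exists_subseq (y := fun n => (p n).1) (x := fun n => (p n).2) hR
    (hA.isBounded.subset (range_subset_iff.2 fun n => (hp n).1)) (fun n => (hp n).2)
  have hab : Tendsto (p ∘ φ) atTop (𝓝 (a, b)) := ha.prodMk_nhds hb
  exact ⟨(a, b), hcl.mem_of_tendsto hab (Eventually.of_forall fun n => hp _), φ, hφ, hab⟩

end Coercivity

/-! ### Tightness, optimal couplings and existence of a barycenter -/

section Existence

variable {X : Type*} [MetricSpace X] [CompleteSpace X] [SecondCountableTopology X]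
    [MeasurableSpace X] [BorelSpace X] {c : X → X → ℝ≥0∞}

/-- Couplings with bounded cost whose second marginals are dominated by a fixed finite measure are
uniformly tight. -/
lemma IsAdmissibleCost.exists_tight (hc : IsAdmissibleCost c) (ν : Measure X) [IsFiniteMeasure ν]
    (M : ℝ≥0) : ∃ (u : ℕ → ℝ≥0) (B : ℕ → Set (X × X)), Tendsto u atTop (𝓝 0) ∧
      (∀ n, IsCompact (B n)) ∧ ∀ π : Measure (X × X), π.snd ≤ ν → ∫⁻ p, c p.1 p.2 ∂π ≤ M →
        ∀ n, π (B n)ᶜ ≤ u n := by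
  have hA : ∀ n : ℕ, ∃ A : Set X, IsCompact A ∧ ν Aᶜ ≤ ((n + 1 : ℝ≥0)⁻¹ : ℝ≥0) := fun n =>
    isTightMeasureSet_iff_exists_isCompact_measure_compl_le.1
      (isTightMeasureSet_singleton (μ := ν)) _ (by positivity) |>.imp
        fun A hA => ⟨hA.1, hA.2 ν rfl⟩
  choose A hAc hA using hA
  -- The first summand bounds the mass whose second coordinate leaves `A n`; the second is Markov's
  -- inequality for the event that the cost is at least `n + 1`.
  refine ⟨fun n => (n + 1 : ℝ≥0)⁻¹ + M * (n + 1 : ℝ≥0)⁻¹,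
    fun n => {p | p.2 ∈ A n ∧ c p.1 p.2 ≤ ((n + 1 : ℝ≥0) : ℝ≥0∞)}, ?_, fun n =>
      hc.isCompact_sublevel (hAc n) ENNReal.coe_ne_top, fun π hπ hM n => ?_⟩
  · have h : Tendsto (fun n : ℕ => (n + 1 : ℝ≥0)⁻¹) atTop (𝓝 0) := by
      simpa using tendsto_one_div_add_atTop_nhds_zero_nat (𝕜 := ℝ≥0)
    simpa using h.add (h.const_mul M)
  · have hm : Measurable fun p : X × X => c p.1 p.2 := hc.lsc.measurable
    have hsub : {p : X × X | p.2 ∈ A n ∧ c p.1 p.2 ≤ ((n + 1 : ℝ≥0) : ℝ≥0∞)}ᶜ ⊆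
        Prod.snd ⁻¹' (A n)ᶜ ∪ {p | ((n + 1 : ℝ≥0) : ℝ≥0∞) ≤ c p.1 p.2} := by
      intro p hp
      simp only [mem_compl_iff, mem_ofPred_eq, not_and_or, not_le] at hp
      exact hp.imp id le_of_lt
    refine (measure_mono hsub).trans ((measure_union_le _ _).trans ?_)
    change _ ≤ (((n + 1 : ℝ≥0)⁻¹ + M * (n + 1 : ℝ≥0)⁻¹ : ℝ≥0) : ℝ≥0∞)
    rw [ENNReal.coe_add ((n + 1 : ℝ≥0)⁻¹), ENNReal.coe_mul]
    gcongr
    · rw [← Measure.snd_apply (hAc n).measurableSet.compl]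
      exact (hπ _).trans (hA n)
    · have h := meas_ge_le_lintegral_div hm.aemeasurable (μ := π)
        (ε := ((n + 1 : ℝ≥0) : ℝ≥0∞)) (by positivity) ENNReal.coe_ne_top
      refine h.trans ?_
      rw [ENNReal.coe_inv (by positivity), ← div_eq_mul_inv]
      gcongr

lemma IsAdmissibleCost.exists_optimal_coupling (hc : IsAdmissibleCost c) (ρ ν : Measure X)
    [IsFiniteMeasure ν] (h : transportCost c ρ ν ≠ ⊤) :
    ∃ π : Measure (X × X), π.fst = ρ ∧ π.snd = ν ∧ ∫⁻ p, c p.1 p.2 ∂π = transportCost c ρ ν := by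
  obtain ⟨M, hM⟩ : ∃ M : ℝ≥0, (M : ℝ≥0∞) = transportCost c ρ ν := ⟨_, ENNReal.coe_toNNReal h⟩
  -- The budget `M + 1` exceeds the infimum `M`, so some coupling meets it before attainment is
  -- known.
  obtain ⟨u, B, hu, hB, hπ⟩ := hc.exists_tight ν (M + 1)
  have hfin : ∀ π : Measure (X × X), π.snd = ν → IsFiniteMeasure π := fun π hs =>
    ⟨by rw [← Measure.snd_univ, hs]; exact measure_lt_top _ _⟩
  let S : Set (FiniteMeasure (X × X)) := {π | (π : Measure (X × X)).fst = ρ ∧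
    (π : Measure (X × X)).snd = ν}
  let T : Set (FiniteMeasure (X × X)) := {π | π.mass ≤ (ν univ).toNNReal ∧ ∀ n, π (B n)ᶜ ≤ u n}
  have hT : IsCompact T :=
    isCompact_setOfPred_finiteMeasure_mass_le_compl_isCompact_le _ hu hB (Or.inl inferInstance)
  have hST : ∀ π : Measure (X × X), π.fst = ρ → π.snd = ν → ∫⁻ p, c p.1 p.2 ∂π ≤ (M + 1 : ℝ≥0) →
      ∃ π' ∈ S ∩ T, (π' : Measure (X × X)) = π := fun π h1 h2 h3 => by
    have := hfin π h2
    refine ⟨⟨π, this⟩, ⟨⟨h1, h2⟩, ?_, fun n => ?_⟩, rfl⟩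
    · refine ENNReal.toNNReal_mono (measure_ne_top _ _) ?_
      rw [← h2, Measure.snd_univ]
      rfl
    · exact ENNReal.coe_le_coe.1 (by simpa using hπ π h2.le h3 n)
  have hex : ∀ a : ℝ≥0∞, transportCost c ρ ν < a → ∃ π : Measure (X × X), π.fst = ρ ∧ π.snd = ν ∧
      ∫⁻ p, c p.1 p.2 ∂π < a := fun a ha => by
    simpa only [transportCost, iInf_lt_iff, exists_prop] using ha
  obtain ⟨π₀, h1, h2, h3⟩ := hex (M + 1 : ℝ≥0) (by rw [← hM]; exact_mod_cast lt_add_one M)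
  have hρfin : IsFiniteMeasure ρ := by have := hfin _ h2; rw [← h1]; infer_instance
  have hS : IsClosed S := by
    have e : S = {π | π.map Prod.fst = ⟨ρ, hρfin⟩} ∩ {π | π.map Prod.snd = ⟨ν, inferInstance⟩} := by
      ext π
      simp only [S, mem_ofPred_eq, mem_inter_iff, map_eq_mk_iff, Measure.fst, Measure.snd]
    rw [e]
    exact (isClosed_eq (FiniteMeasure.continuous_map continuous_fst) continuous_const).inter
      (isClosed_eq (FiniteMeasure.continuous_map continuous_snd) continuous_const)
  obtain ⟨π₁, hπ₁, -⟩ := hST π₀ h1 h2 h3.le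
  obtain ⟨π, hπST, hmin⟩ := ((lowerSemicontinuous_lintegral hc.lsc).lowerSemicontinuousOn
    (S ∩ T)).exists_isMinOn ⟨π₁, hπ₁⟩ (hT.inter_left hS)
  refine ⟨π, hπST.1.1, hπST.1.2, le_antisymm ?_ ?_⟩
  · refine le_of_forall_gt fun a ha => ?_
    obtain ⟨π', h1, h2, h3⟩ := hex (min a (M + 1 : ℝ≥0))
      (lt_min ha (by rw [← hM]; exact_mod_cast lt_add_one M))
    obtain ⟨π'', hπ'', rfl⟩ := hST π' h1 h2 (h3.le.trans (min_le_right _ _))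
    exact (isMinOn_iff.1 hmin π'' hπ'').trans_lt (h3.trans_le (min_le_left _ _))
  · exact iInf_le_of_le _ (iInf₂_le_of_le hπST.1.1 hπST.1.2 le_rfl)

lemma transportCost_le {Y : Type*} [MeasurableSpace Y] (c : Y → Y → ℝ≥0∞) (π : Measure (Y × Y)) :
    transportCost c π.fst π.snd ≤ ∫⁻ p, c p.1 p.2 ∂π :=
  iInf_le_of_le π (iInf₂_le_of_le rfl rfl le_rfl)

omit [CompleteSpace X] in
lemma IsAdmissibleCost.transportCost_self (hc : IsAdmissibleCost c) (ν : Measure X) :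
    transportCost c ν ν = 0 := by
  have hm : Measurable fun x : X => (x, x) := measurable_id.prodMk measurable_id
  have h := transportCost_le c (ν.map fun x => (x, x))
  have h1 : (ν.map fun x => (x, x)).fst = ν :=
    (Measure.fst_map_prodMk (X := id) measurable_id).trans Measure.map_id
  have h2 : (ν.map fun x => (x, x)).snd = ν :=
    (Measure.snd_map_prodMk (Y := id) measurable_id).trans Measure.map_id
  rw [h1, h2, lintegral_map hc.lsc.measurable hm] at h
  simpa [hc.self_eq_zero] using h

lemma measure_le_sum {Y ι : Type*} [Fintype ι] [MeasurableSpace Y] (ρ : ι → Measure Y) (i : ι) :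
    ρ i ≤ ∑ j, ρ j := by
  refine Measure.le_iff'.2 fun s => ?_
  rw [Measure.finsetSum_apply]
  exact Finset.single_le_sum (f := fun j => ρ j s) (fun _ _ => zero_le) (Finset.mem_univ i)

theorem IsAdmissibleCost.exists_isBarySolution (hc : IsAdmissibleCost c) {K : ℕ}
    (μ : Fin K → Measure X) [∀ i, IsFiniteMeasure (μ i)] :
    ∃ (lam : Measure X) (μt : Fin K → Measure X), IsBarySolution c μ lam μt ∧
      baryObjective c μ lam μt ≠ ⊤ := by
  -- The competitor `lam = ν`, `μt = μ` transports nothing and costs `ν univ`; this is the budget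
  -- `M` for all other candidates.
  set ν : Measure X := ∑ i, μ i with hν
  obtain ⟨M, hM⟩ : ∃ M : ℝ≥0, (M : ℝ≥0∞) = ν univ := ⟨_, ENNReal.coe_toNNReal (measure_ne_top _ _)⟩
  obtain ⟨u, B, hu, hB, hπ⟩ := hc.exists_tight ν M
  let S : Set (FiniteMeasure X × (Fin K → FiniteMeasure (X × X))) :=
    {y | (∀ i, (y.2 i : Measure (X × X)).fst ≤ y.1) ∧ ∀ i, (y.2 i : Measure (X × X)).snd = μ i}
  let T : Set (FiniteMeasure X × (Fin K → FiniteMeasure (X × X))) :=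
    {lam | lam.mass ≤ M ∧ ∀ n, lam (Prod.fst '' B n)ᶜ ≤ K * u n} ×ˢ
      univ.pi fun _ => {π | π.mass ≤ M ∧ ∀ n, π (B n)ᶜ ≤ u n}
  let J : FiniteMeasure X × (Fin K → FiniteMeasure (X × X)) → ℝ≥0∞ := fun y =>
    y.1.mass + ∑ i, ∫⁻ p, c p.1 p.2 ∂(y.2 i : Measure (X × X))
  have hT : IsCompact T := by
    refine IsCompact.prod ?_ (isCompact_univ_pi fun i => ?_)
    · exact isCompact_setOfPred_finiteMeasure_mass_le_compl_isCompact_le _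
        (by simpa using hu.const_mul (K : ℝ≥0)) (fun n => (hB n).image continuous_fst)
        (Or.inl inferInstance)
    · exact isCompact_setOfPred_finiteMeasure_mass_le_compl_isCompact_le _ hu hB (Or.inl inferInstance)
  have hcoord : ∀ i, Continuous fun y : FiniteMeasure X × (Fin K → FiniteMeasure (X × X)) =>
    y.2 i := fun i => (continuous_apply i).comp continuous_snd
  have hS : IsClosed S := by
    have e : S = (⋂ i, {y | (((y.2 i).map Prod.fst : FiniteMeasure X) : Measure X) ≤ y.1}) ∩
        ⋂ i, {y | (y.2 i).map Prod.snd = ⟨μ i, inferInstance⟩} := by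
      ext y
      simp only [S, mem_ofPred_eq, mem_inter_iff, mem_iInter, map_eq_mk_iff, Measure.fst,
        Measure.snd, FiniteMeasure.toMeasure_map]
    rw [e]
    refine (isClosed_iInter fun i => isClosed_setOf_measure_le
      ((FiniteMeasure.continuous_map continuous_fst).comp (hcoord i)) continuous_fst).inter
      (isClosed_iInter fun i => isClosed_eq
        ((FiniteMeasure.continuous_map continuous_snd).comp (hcoord i)) continuous_const)
  have hJ : LowerSemicontinuous J := by
    refine LowerSemicontinuous.add ?_ (lowerSemicontinuous_sum fun i _ =>
      (lowerSemicontinuous_lintegral hc.lsc).comp (hcoord i))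
    exact (ENNReal.continuous_coe.comp
      (FiniteMeasure.continuous_mass.comp continuous_fst)).lowerSemicontinuous
  have claim : ∀ lam μt, BaryFeasible lam μt → baryObjective c μ lam μt ≤ M →
      ∃ y ∈ S ∩ T, J y ≤ baryObjective c μ lam μt := by
    intro lam μt ⟨hfin, hle⟩ hobj
    have hcost : ∑ i, transportCost c (μt i) (μ i) ≤ M := le_add_self.trans hobj
    have hcost' : ∀ i, transportCost c (μt i) (μ i) ≤ M := fun i =>
      (Finset.single_le_sum (f := fun i => transportCost c (μt i) (μ i))
        (fun _ _ => zero_le) (Finset.mem_univ i)).trans hcost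
    have hex := fun i => hc.exists_optimal_coupling (μt i) (μ i)
      (((hcost' i).trans_lt ENNReal.coe_lt_top).ne)
    choose π hπ1 hπ2 hπ3 using hex
    have hπfin : ∀ i, IsFiniteMeasure (π i) := fun i =>
      ⟨by rw [← Measure.snd_univ, hπ2]; exact measure_lt_top _ _⟩
    have hπν : ∀ i, (π i).snd ≤ ν := fun i => (hπ2 i).le.trans (measure_le_sum μ i)
    have htight : ∀ i n, π i (B n)ᶜ ≤ u n := fun i =>
      hπ (π i) (hπν i) ((hπ3 i).le.trans (hcost' i))
    -- An arbitrary feasible `lam` need not satisfy the tightness bounds. Replacing it by the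
    -- smallest feasible measure `⨆ i, μt i` does not raise the objective, and domination by `∑ i,
    -- μt i` yields the bound `K * u n`.
    have hsup : (⨆ i, μt i) ≤ lam := iSup_le hle
    have hsum : (⨆ i, μt i) ≤ ∑ i, μt i := iSup_le fun i => measure_le_sum μt i
    have hsfin : IsFiniteMeasure (⨆ i, μt i) := isFiniteMeasure_of_le lam hsup
    refine ⟨(⟨⨆ i, μt i, hsfin⟩, fun i => ⟨π i, hπfin i⟩), ⟨⟨fun i => ?_, hπ2⟩,
      ⟨?_, fun n => ?_⟩, fun i _ => ⟨?_, fun n => ?_⟩⟩, ?_⟩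
    · exact (hπ1 i).le.trans (le_iSup μt i)
    · rw [← ENNReal.coe_le_coe, FiniteMeasure.ennreal_mass]
      exact (hsup univ).trans (le_self_add.trans hobj)
    · rw [← ENNReal.coe_le_coe, FiniteMeasure.ennreal_coeFn_eq_coeFn_toMeasure]
      refine (hsum _).trans ?_
      rw [Measure.finsetSum_apply, ENNReal.coe_mul]
      have : ∀ i ∈ Finset.univ, μt i (Prod.fst '' B n)ᶜ ≤ u n := fun i _ => by
        rw [← hπ1 i, Measure.fst_apply ((hB n).image continuous_fst).measurableSet.compl]
        refine (measure_mono ?_).trans (htight i n)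
        exact fun p hp hpB => hp (mem_image_of_mem _ hpB)
      refine (Finset.sum_le_card_nsmul _ _ _ this).trans ?_
      simp
    · rw [← ENNReal.coe_le_coe, FiniteMeasure.ennreal_mass, hM]
      change π i univ ≤ _
      rw [← Measure.snd_univ]
      exact hπν i univ
    · rw [← ENNReal.coe_le_coe, FiniteMeasure.ennreal_coeFn_eq_coeFn_toMeasure]
      exact htight i n
    · simp only [J, FiniteMeasure.ennreal_mass]
      refine add_le_add (hsup univ) (Finset.sum_le_sum fun i _ => (hπ3 i).le)
  have hfeas : BaryFeasible ν μ := ⟨inferInstance, fun i => measure_le_sum μ i⟩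
  have hobj : baryObjective c μ ν μ ≤ M := by
    simp [baryObjective, hc.transportCost_self, hM]
  obtain ⟨y₀, hy₀, hJ₀⟩ := claim ν μ hfeas hobj
  obtain ⟨y, hy, hmin⟩ := (hJ.lowerSemicontinuousOn (S ∩ T)).exists_isMinOn ⟨y₀, hy₀⟩
    (hT.inter_left hS)
  have hyJ : baryObjective c μ y.1 (fun i => (y.2 i : Measure (X × X)).fst) ≤ J y := by
    simp only [J, FiniteMeasure.ennreal_mass]
    refine add_le_add le_rfl (Finset.sum_le_sum fun i _ => ?_)
    rw [← hy.1.2 i]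
    exact transportCost_le c _
  have hJM : J y ≤ M := (isMinOn_iff.1 hmin y₀ hy₀).trans (hJ₀.trans hobj)
  refine ⟨y.1, fun i => (y.2 i : Measure (X × X)).fst, ⟨⟨inferInstance, hy.1.1⟩,
    fun lam' μt' hf' => hyJ.trans ?_⟩, ((hyJ.trans hJM).trans_lt ENNReal.coe_lt_top).ne⟩
  by_contra! hlt
  obtain ⟨y', hy', hJ'⟩ := claim lam' μt' hf' (hlt.le.trans hJM)
  exact (isMinOn_iff.1 hmin y' hy').not_gt (hJ'.trans_lt hlt)

end Existence

/-! ### Product Bernoulli weights on subsets -/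

section Weights

/-- The weights of a product Bernoulli distribution with parameters `h i`. -/
noncomputable def bernoulliWeight {K : ℕ} (h : Fin K → ℝ≥0∞) (A : Finset (Fin K)) : ℝ≥0∞ :=
  (∏ i ∈ A, h i) * ∏ i ∈ Finset.univ \ A, (1 - h i)

variable {K : ℕ} {h : Fin K → ℝ≥0∞}

/-- This is the expansion of `∏ i, (h i + (1 - h i))`; truncated subtraction requires `h i ≤ 1`. -/
lemma sum_bernoulliWeight (hh : ∀ i, h i ≤ 1) :
    ∑ A : Finset (Fin K), bernoulliWeight h A = 1 := by
  have := Finset.prod_add h (fun i => 1 - h i) Finset.univ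
  simp only [add_tsub_cancel_of_le (hh _), Finset.prod_const_one, Finset.powerset_univ] at this
  exact this.symm

/-- Setting the parameter `i` to `1` gives the conditional weight of `A` given `i ∈ A`, without a
division by `h i`, which may vanish. -/
lemma bernoulliWeight_update_of_mem (h : Fin K → ℝ≥0∞) {A : Finset (Fin K)} {i : Fin K}
    (hi : i ∈ A) : h i * bernoulliWeight (Function.update h i 1) A = bernoulliWeight h A := by
  unfold bernoulliWeight
  have h1 : ∀ j ∈ Finset.univ \ A, 1 - Function.update h i 1 j = 1 - h j := fun j hj => by
    rw [Function.update_of_ne]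
    rintro rfl
    simp [hi] at hj
  rw [Finset.prod_congr rfl h1, Finset.prod_update_of_mem hi, one_mul, ← mul_assoc,
    Finset.sdiff_singleton_eq_erase, Finset.mul_prod_erase _ _ hi]

lemma bernoulliWeight_update_of_notMem (h : Fin K → ℝ≥0∞) {A : Finset (Fin K)} {i : Fin K}
    (hi : i ∉ A) : bernoulliWeight (Function.update h i 1) A = 0 := by
  unfold bernoulliWeight
  rw [Finset.prod_eq_zero (s := Finset.univ \ A) (i := i) (by simp [hi]) (by simp), mul_zero]

lemma sum_bernoulliWeight_update (hh : ∀ i, h i ≤ 1) (i : Fin K) :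
    ∑ A ∈ (labelSets K).filter (fun A => i ∈ A), bernoulliWeight (Function.update h i 1) A = 1 := by
  have hu : ∀ j, Function.update h i 1 j ≤ 1 := fun j => by
    by_cases hj : j = i
    · subst hj; simp
    · simpa [hj] using hh j
  refine Eq.trans ?_ (sum_bernoulliWeight hu)
  refine Finset.sum_subset (Finset.subset_univ _) fun A _ hA => ?_
  refine bernoulliWeight_update_of_notMem h fun hi => hA ?_
  simp only [labelSets, Finset.mem_filter, Finset.mem_univ, true_and]
  exact ⟨⟨i, hi⟩, hi⟩

lemma measurable_bernoulliWeight {Y : Type*} [MeasurableSpace Y] {g : Fin K → Y → ℝ≥0∞}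
    (hg : ∀ i, Measurable (g i)) (A : Finset (Fin K)) :
    Measurable fun y => bernoulliWeight (fun i => g i y) A :=
  (Finset.measurable_prod _ fun i _ => hg i).mul
    (Finset.measurable_prod _ fun i _ => measurable_const.sub (hg i))

end Weights

/-! ### Subadditivity of transport cost and measures with densities -/

section Transport

variable {Y : Type*} [MeasurableSpace Y] (c : Y → Y → ℝ≥0∞)

lemma transportCost_zero : transportCost c (0 : Measure Y) 0 = 0 := by
  simpa using transportCost_le c (0 : Measure (Y × Y))

lemma transportCost_add_le (ρ₁ ρ₂ ν₁ ν₂ : Measure Y) :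
    transportCost c (ρ₁ + ρ₂) (ν₁ + ν₂) ≤ transportCost c ρ₁ ν₁ + transportCost c ρ₂ ν₂ := by
  rw [transportCost, transportCost, transportCost]
  simp_rw [ENNReal.iInf_add, ENNReal.add_iInf]
  refine le_iInf fun π₁ => le_iInf fun h₁ => le_iInf fun h₂ => le_iInf fun π₂ => le_iInf fun h₃ =>
    le_iInf fun h₄ => ?_
  refine (iInf₂_le_of_le (π₁ + π₂) ?_ (iInf_le _ ?_)).trans_eq (lintegral_add_measure _ _ _)
  · rw [Measure.fst, Measure.map_add _ _ measurable_fst, ← h₁, ← h₃]; rfl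
  · rw [Measure.snd, Measure.map_add _ _ measurable_snd, ← h₂, ← h₄]; rfl

lemma transportCost_sum_le {ι : Type*} (s : Finset ι) (ρ ν : ι → Measure Y) :
    transportCost c (∑ i ∈ s, ρ i) (∑ i ∈ s, ν i) ≤ ∑ i ∈ s, transportCost c (ρ i) (ν i) := by
  classical
  induction s using Finset.induction_on with
  | empty => simp [transportCost_zero]
  | insert a s ha ih =>
    simp only [Finset.sum_insert ha]
    exact (transportCost_add_le c _ _ _ _).trans (add_le_add le_rfl ih)

lemma fst_withDensity_comp (π : Measure (Y × Y)) {q : Y → ℝ≥0∞} (hq : Measurable q) :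
    (π.withDensity fun p => q p.1).fst = π.fst.withDensity q := by
  ext s hs
  rw [Measure.fst_apply hs, withDensity_apply _ (measurable_fst hs), withDensity_apply _ hs,
    Measure.fst, setLIntegral_map hs hq measurable_fst]

lemma sum_withDensity {ι : Type*} (s : Finset ι) (ν : Measure Y) {f : ι → Y → ℝ≥0∞}
    (hf : ∀ i, Measurable (f i)) :
    ∑ i ∈ s, ν.withDensity (f i) = ν.withDensity fun y => ∑ i ∈ s, f i y := by
  ext t ht
  simp_rw [Measure.finsetSum_apply, withDensity_apply _ ht]
  rw [lintegral_finsetSum _ fun i _ => hf i]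

end Transport

/-! ### Equivalence of the generalized and the stratified problem -/

section Stratification

variable {Y : Type*} [MeasurableSpace Y] {K : ℕ}

lemma sum_labelSets_add {M : Type*} [AddCommMonoid M] (g : Finset (Fin K) → M) :
    ∑ A ∈ labelSets K, g A + g ∅ = ∑ A, g A := by
  rw [labelSets, ← Finset.sum_filter_add_sum_filter_not Finset.univ (fun A => A.Nonempty) g]
  congr 1
  have : (Finset.univ.filter fun A : Finset (Fin K) => ¬A.Nonempty) = {∅} := by
    ext A; simp
  rw [this, Finset.sum_singleton]

lemma sum_labelSets_sum_comm {M : Type*} [AddCommMonoid M] (g : Fin K → Finset (Fin K) → M) :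
    ∑ A ∈ labelSets K, ∑ i ∈ A, g i A =
      ∑ i, ∑ A ∈ (labelSets K).filter (fun A => i ∈ A), g i A := by
  simp_rw [Finset.sum_filter]
  rw [Finset.sum_comm]
  refine Finset.sum_congr rfl fun A _ => ?_
  rw [← Finset.sum_filter, Finset.filter_mem_eq_inter, Finset.univ_inter]

/-- A feasible point of the generalized barycenter problem, together with couplings, is split into
strata by means of products of the densities `dμt i / dlam`. -/
lemma exists_stratification (c : Y → Y → ℝ≥0∞)
    {μ μt : Fin K → Measure Y} {lam : Measure Y} [IsFiniteMeasure lam] (hle : ∀ i, μt i ≤ lam)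
    {π : Fin K → Measure (Y × Y)} (h1 : ∀ i, (π i).fst = μt i) (h2 : ∀ i, (π i).snd = μ i) :
    ∃ (lamA : Finset (Fin K) → Measure Y) (μA : Fin K → Finset (Fin K) → Measure Y)
      (lam₀ : Measure Y), StratFeasible μ lamA μA ∧ ∑ A ∈ labelSets K, lamA A + lam₀ = lam ∧
        stratObjective c lamA μA + lam₀ univ ≤ lam univ + ∑ i, ∫⁻ p, c p.1 p.2 ∂(π i) := by
  have hfin : ∀ i, IsFiniteMeasure (μt i) := fun i => isFiniteMeasure_of_le lam (hle i)
  -- The density is at most `1` only almost everywhere; truncation makes the Bernoulli identities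
  -- hold at every point.
  let h : Fin K → Y → ℝ≥0∞ := fun i y => min ((μt i).rnDeriv lam y) 1
  have hh : ∀ y i, h i y ≤ 1 := fun y i => min_le_right _ _
  have hm : ∀ i, Measurable (h i) := fun i => (Measure.measurable_rnDeriv _ _).min measurable_const
  have hd : ∀ i, lam.withDensity (h i) = μt i := fun i => by
    rw [← Measure.withDensity_rnDeriv_eq (μt i) lam (Measure.absolutelyContinuous_of_le (hle i))]
    refine withDensity_congr_ae ?_
    filter_upwards [Measure.rnDeriv_le_one_of_le (hle i)] with y hy
    exact min_eq_left hy
  let w : Finset (Fin K) → Y → ℝ≥0∞ := fun A y => bernoulliWeight (fun i => h i y) A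
  have hw : ∀ A, Measurable (w A) := measurable_bernoulliWeight hm
  -- The share of `π i` going to stratum `A`. Since `h i * q i A = w A` for `i ∈ A`, all the split
  -- couplings of a stratum have the same first marginal `lamA A`.
  let q : Fin K → Finset (Fin K) → Y → ℝ≥0∞ := fun i A y =>
    bernoulliWeight (Function.update (fun j => h j y) i 1) A
  have hq : ∀ i A, Measurable (q i A) := fun i A => by
    have : q i A = fun y => bernoulliWeight (fun j => Function.update h i 1 j y) A := by
      funext y
      refine congrArg (fun g => bernoulliWeight g A) (funext fun j => ?_)
      by_cases hj : j = i
      · subst hj; simp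
      · simp [hj]
    rw [this]
    refine measurable_bernoulliWeight (fun j => ?_) A
    by_cases hj : j = i
    · subst hj; simpa using measurable_one
    · simpa [hj] using hm j
  let lamA : Finset (Fin K) → Measure Y := fun A => lam.withDensity (w A)
  let πA : Fin K → Finset (Fin K) → Measure (Y × Y) := fun i A =>
    (π i).withDensity fun p => q i A p.1
  have hlam : ∑ A ∈ labelSets K, lamA A + lamA ∅ = lam := by
    rw [sum_labelSets_add, sum_withDensity _ _ hw]
    simp only [w, sum_bernoulliWeight (hh _)]
    exact withDensity_one
  have hπA : ∀ i, ∑ A ∈ (labelSets K).filter (fun A => i ∈ A), πA i A = π i := fun i => by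
    rw [sum_withDensity (f := fun A (p : Y × Y) => q i A p.1) _ _
      fun A => (hq i A).comp measurable_fst]
    simp only [q, sum_bernoulliWeight_update (hh _)]
    exact withDensity_one
  have hfst : ∀ A, ∀ i ∈ A, (πA i A).fst = lamA A := fun A i hi => by
    rw [fst_withDensity_comp _ (hq i A), h1, ← hd i, ← withDensity_mul _ (hm i) (hq i A)]
    congr 1
    funext y
    exact bernoulliWeight_update_of_mem (fun j => h j y) hi
  refine ⟨lamA, fun i A => (πA i A).snd, lamA ∅, ⟨fun A hA => ?_, fun i => ?_⟩, hlam, ?_⟩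
  · refine isFiniteMeasure_of_le lam ?_
    conv_rhs => rw [← hlam, sum_labelSets_add]
    exact measure_le_sum lamA A
  · rw [← h2 i, ← hπA i, Measure.snd, Measure.map_finset_sum measurable_snd.aemeasurable]
    rfl
  · have hsum : ∑ A ∈ labelSets K, ∑ i ∈ A, ∫⁻ p, c p.1 p.2 ∂(πA i A) =
        ∑ i, ∫⁻ p, c p.1 p.2 ∂(π i) := by
      rw [sum_labelSets_sum_comm]
      refine Finset.sum_congr rfl fun i _ => ?_
      rw [← lintegral_finsetSum_measure, hπA]
    rw [← hsum, stratObjective, Finset.sum_add_distrib]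
    conv_rhs => rw [← hlam]
    rw [Measure.add_apply, Measure.finsetSum_apply, add_right_comm]
    refine add_le_add le_rfl (Finset.sum_le_sum fun A _ => Finset.sum_le_sum fun i hi => ?_)
    rw [← hfst A i hi]
    exact transportCost_le c _

lemma baryFeasible_of_stratFeasible {μ : Fin K → Measure Y} {lamA : Finset (Fin K) → Measure Y}
    {μA : Fin K → Finset (Fin K) → Measure Y} (h : StratFeasible μ lamA μA) :
    BaryFeasible (∑ A ∈ labelSets K, lamA A)
      (fun i => ∑ A ∈ (labelSets K).filter (fun A => i ∈ A), lamA A) := by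
  refine ⟨⟨?_⟩, fun i => Measure.le_iff'.2 fun s => ?_⟩
  · rw [Measure.finsetSum_apply]
    exact ENNReal.sum_lt_top.2 fun A hA => (h.1 A hA).measure_univ_lt_top
  · rw [Measure.finsetSum_apply, Measure.finsetSum_apply]
    exact Finset.sum_le_sum_of_subset (Finset.filter_subset _ _)

/-- Adding couplings over the strata containing `i` can only overestimate the transport cost between
the sums. -/
lemma baryObjective_le_stratObjective (c : Y → Y → ℝ≥0∞) {μ : Fin K → Measure Y}
    {lamA : Finset (Fin K) → Measure Y}
    {μA : Fin K → Finset (Fin K) → Measure Y} (h : StratFeasible μ lamA μA) :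
    baryObjective c μ (∑ A ∈ labelSets K, lamA A)
      (fun i => ∑ A ∈ (labelSets K).filter (fun A => i ∈ A), lamA A) ≤
      stratObjective c lamA μA := by
  rw [baryObjective, stratObjective, Finset.sum_add_distrib, Measure.finsetSum_apply,
    sum_labelSets_sum_comm]
  refine add_le_add le_rfl (Finset.sum_le_sum fun i _ => ?_)
  rw [← h.2 i]
  exact transportCost_sum_le c _ _ _

variable {X : Type*} [MetricSpace X] [CompleteSpace X] [SecondCountableTopology X]
    [MeasurableSpace X] [BorelSpace X] {c : X → X → ℝ≥0∞} {μ : Fin K → Measure X}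
    [∀ i, IsFiniteMeasure (μ i)]

lemma IsAdmissibleCost.baryObjective_ne_top (hc : IsAdmissibleCost c) {lam : Measure X}
    {μt : Fin K → Measure X} (h : IsBarySolution c μ lam μt) : baryObjective c μ lam μt ≠ ⊤ := by
  obtain ⟨lam', μt', h', hfin⟩ := hc.exists_isBarySolution μ
  exact ((h.2 lam' μt' h'.1).trans_lt hfin.lt_top).ne

theorem IsAdmissibleCost.exists_isStratSolution (hc : IsAdmissibleCost c) {lam : Measure X}
    {μt : Fin K → Measure X} (h : IsBarySolution c μ lam μt) :
    ∃ (lamA : Finset (Fin K) → Measure X) (μA : Fin K → Finset (Fin K) → Measure X),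
      IsStratSolution c μ lamA μA ∧ ∑ A ∈ labelSets K, lamA A = lam ∧
        stratObjective c lamA μA ≤ baryObjective c μ lam μt := by
  have hfin := h.1.1
  have hne := hc.baryObjective_ne_top h
  have hcost : ∀ i, transportCost c (μt i) (μ i) ≠ ⊤ := fun i => by
    have := (ENNReal.add_ne_top.1 hne).2
    exact ENNReal.sum_ne_top.1 this i (Finset.mem_univ i)
  choose π h1 h2 h3 using fun i => hc.exists_optimal_coupling (μt i) (μ i) (hcost i)
  obtain ⟨lamA, μA, lam₀, hf, hsum, hobj⟩ := exists_stratification c h.1.2 h1 h2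
  have hobj' : stratObjective c lamA μA + lam₀ univ ≤ baryObjective c μ lam μt := by
    simp only [h3] at hobj
    exact hobj
  have hlow : ∀ (lamA' : Finset (Fin K) → Measure X) (μA' : Fin K → Finset (Fin K) → Measure X),
      StratFeasible μ lamA' μA' → baryObjective c μ lam μt ≤ stratObjective c lamA' μA' :=
    fun lamA' μA' hf' => (h.2 _ _ (baryFeasible_of_stratFeasible hf')).trans
      (baryObjective_le_stratObjective c hf')
  have hle : stratObjective c lamA μA ≤ baryObjective c μ lam μt := le_self_add.trans hobj'
  -- The strata without `lam₀` are feasible, hence cost at least the optimal value, which already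
  -- includes the mass of `lam₀`.
  have h0 : lam₀ univ = 0 := by
    have := hobj'.trans (hlow _ _ hf)
    have hne' : stratObjective c lamA μA ≠ ⊤ := (hle.trans_lt hne.lt_top).ne
    by_contra h0
    exact (ENNReal.lt_add_right hne' h0).not_ge this
  refine ⟨lamA, μA, ⟨hf, fun lamA' μA' hf' => hle.trans (hlow _ _ hf')⟩, ?_, hle⟩
  rwa [Measure.measure_univ_eq_zero.1 h0, add_zero] at hsum

theorem IsAdmissibleCost.isOptimalBarycenter_of_isStratSolution (hc : IsAdmissibleCost c)
    {lamA : Finset (Fin K) → Measure X} {μA : Fin K → Finset (Fin K) → Measure X}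
    (h : IsStratSolution c μ lamA μA) :
    IsOptimalBarycenter c μ (∑ A ∈ labelSets K, lamA A) ∧ stratObjective c lamA μA ≠ ⊤ := by
  obtain ⟨lam₀, μt₀, h₀, hfin⟩ := hc.exists_isBarySolution μ
  obtain ⟨lamA', μA', h', -, hle⟩ := hc.exists_isStratSolution h₀
  have hA := (h.2 _ _ h'.1).trans hle
  exact ⟨⟨_, baryFeasible_of_stratFeasible h.1, fun lam' μt' hf' =>
    (baryObjective_le_stratObjective c h.1).trans (hA.trans (h₀.2 _ _ hf'))⟩,
    (hA.trans_lt hfin.lt_top).ne⟩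

end Stratification

/-! ### Gluing couplings along a common marginal -/

section Gluing

open ProbabilityTheory

variable {Y X ι : Type*} [MeasurableSpace Y] [MeasurableSpace X] [Fintype ι]

lemma measurable_measurePi (κ : ι → Kernel Y X) [∀ i, IsMarkovKernel (κ i)] :
    Measurable fun y => Measure.pi fun i => κ i y := by
  refine .measure_of_isPiSystem_of_isProbabilityMeasure generateFrom_pi.symm isPiSystem_pi ?_
  rintro _ ⟨t, ht, rfl⟩
  simp_rw [Measure.pi_pi]
  exact Finset.measurable_prod _ fun i _ => (κ i).measurable_coe (ht i (mem_univ i))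

/-- Finitely many couplings with a common first marginal can be glued together. -/
lemma exists_glue [StandardBorelSpace X] [Nonempty X] (ν : Measure Y) [IsFiniteMeasure ν]
    (ρ : ι → Measure (Y × X)) (hρ : ∀ i, (ρ i).fst = ν) :
    ∃ γ : Measure (Y × (ι → X)), γ.fst = ν ∧ ∀ i, γ.map (fun p => (p.1, p.2 i)) = ρ i := by
  have hfin : ∀ i, IsFiniteMeasure (ρ i) := fun i =>
    ⟨by rw [← Measure.fst_univ, hρ]; exact measure_lt_top _ _⟩
  -- The coordinates are made conditionally independent given `y`.
  let κ : Kernel Y (ι → X) := ⟨fun y => Measure.pi fun i => (ρ i).condKernel y,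
    measurable_measurePi fun i => (ρ i).condKernel⟩
  have hκ : ∀ y, κ y = Measure.pi fun i => (ρ i).condKernel y := fun _ => rfl
  have : IsMarkovKernel κ := ⟨fun y => by rw [hκ]; infer_instance⟩
  refine ⟨ν ⊗ₘ κ, Measure.fst_compProd _ _, fun i => ?_⟩
  have hm : Measurable fun p : Y × (ι → X) => (p.1, p.2 i) := by fun_prop
  rw [← (ρ i).disintegrate (ρ i).condKernel, hρ]
  ext s hs
  rw [Measure.map_apply hm hs, Measure.compProd_apply (hm hs), Measure.compProd_apply hs]
  refine lintegral_congr fun y => ?_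
  rw [hκ, ← (measurePreserving_eval (fun i => (ρ i).condKernel y) i).measure_preimage
    (measurable_prodMk_left hs).nullMeasurableSet]
  rfl

end Gluing

/-! ### Projections of sets of full measure -/

section Projection

/-- The first marginal of a measure concentrated on `G` is concentrated on the projection of `G`,
even if this projection is not Borel. -/
lemma ConcentratedOn.image_fst {Y Z : Type*} [TopologicalSpace Y] [TopologicalSpace Z]
    [PolishSpace Y] [PolishSpace Z] [MeasurableSpace Y] [MeasurableSpace Z] [BorelSpace Y]
    [BorelSpace Z] {γ : Measure (Y × Z)} [IsFiniteMeasure γ] {G : Set (Y × Z)}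
    (h : ConcentratedOn γ G) : ConcentratedOn γ.fst (Prod.fst '' G) := by
  obtain ⟨H, hGH, hH, hH0⟩ := exists_measurable_superset_of_null h
  refine le_antisymm (ENNReal.le_of_forall_pos_le_add fun ε hε _ => ?_) zero_le
  -- A compact `C ⊆ G` carrying all but `ε` of the mass has a compact, hence measurable, projection,
  -- so the possibly non-measurable projection of `G` is never measured directly.
  obtain ⟨C, hCH, hC, hlt⟩ := hH.compl.exists_isCompact_sdiff_lt (measure_ne_top γ _)
    (ENNReal.coe_pos.2 hε).ne'
  have hCG : C ⊆ G := fun p hp => by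
    by_contra hpG
    exact hCH hp (hGH hpG)
  calc γ.fst (Prod.fst '' G)ᶜ ≤ γ.fst (Prod.fst '' C)ᶜ :=
        measure_mono (compl_subset_compl.2 (image_mono hCG))
    _ = γ (Prod.fst ⁻¹' (Prod.fst '' C)ᶜ) :=
        Measure.fst_apply (hC.image continuous_fst).measurableSet.compl
    _ ≤ γ (H ∪ Hᶜ \ C) := measure_mono fun p hp => by
        by_cases hpH : p ∈ H
        · exact Or.inl hpH
        · exact Or.inr ⟨hpH, fun hpC => hp (mem_image_of_mem _ hpC)⟩
    _ ≤ γ H + γ (Hᶜ \ C) := measure_union_le _ _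
    _ ≤ 0 + ε := by rw [hH0]; gcongr

end Projection

/-! ### Measurable selection from closed-valued maps -/

section Selection

variable {X : Type*} [MetricSpace X] [SecondCountableTopology X] [Nonempty X]

/-- The index of the first point of a dense sequence within distance `r` of the set `E`. -/
noncomputable def firstHit (E : Set X) (r : ℝ) : ℕ :=
  sInf {k | (E ∩ Metric.closedBall (TopologicalSpace.denseSeq X k) r).Nonempty}

/-- Shrinking a set by successive intersections with balls around points of a dense sequence. -/
noncomputable def shrink (E : Set X) : ℕ → Set X
  | 0 => E
  | n + 1 => shrink E n ∩ Metric.closedBall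
      (TopologicalSpace.denseSeq X (firstHit (shrink E n) ((1 / 2) ^ n))) ((1 / 2) ^ n)

lemma firstHit_spec {E : Set X} (hE : E.Nonempty) {r : ℝ} (hr : 0 < r) :
    (E ∩ Metric.closedBall (TopologicalSpace.denseSeq X (firstHit E r)) r).Nonempty := by
  obtain ⟨x, hx⟩ := hE
  obtain ⟨k, hk⟩ := (TopologicalSpace.denseRange_denseSeq X).exists_dist_lt x hr
  exact Nat.sInf_mem (s := {k | (E ∩ Metric.closedBall (TopologicalSpace.denseSeq X k) r).Nonempty})
    ⟨k, x, hx, hk.le⟩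

/-- The second alternative reflects the convention `sInf ∅ = 0`. -/
lemma sInf_nat_eq_iff (S : Set ℕ) (k : ℕ) :
    sInf S = k ↔ (k ∈ S ∧ ∀ j < k, j ∉ S) ∨ (k = 0 ∧ ∀ j, j ∉ S) := by
  rcases S.eq_empty_or_nonempty with rfl | hS
  · simp [eq_comm]
  · constructor
    · rintro rfl
      exact Or.inl ⟨Nat.sInf_mem hS, fun j hj => Nat.notMem_of_lt_sInf hj⟩
    · rintro (⟨hk, hlt⟩ | ⟨-, h⟩)
      · exact IsLeast.csInf_eq ⟨hk, fun j hj => not_lt.1 fun hjk => hlt j hjk hj⟩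
      · exact absurd hS.some_mem (h _)

variable {Ω : Type*} [MeasurableSpace Ω]

lemma measurable_firstHit {E : Ω → Set X}
    (hE : ∀ F, IsClosed F → MeasurableSet {ω | (E ω ∩ F).Nonempty}) (r : ℝ) :
    Measurable fun ω => firstHit (E ω) r := by
  refine measurable_to_countable' fun k => ?_
  let S : ℕ → Set Ω := fun j =>
    {ω | (E ω ∩ Metric.closedBall (TopologicalSpace.denseSeq X j) r).Nonempty}
  have h : ∀ j, MeasurableSet (S j) := fun j => hE _ Metric.isClosed_closedBall
  have e : (fun ω => firstHit (E ω) r) ⁻¹' {k} =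
      (S k ∩ ⋂ j, ⋂ (_ : j < k), (S j)ᶜ) ∪ ({_ω | k = 0} ∩ ⋂ j, (S j)ᶜ) := by
    ext ω
    simp [firstHit, sInf_nat_eq_iff, S]
  rw [e]
  exact ((h k).inter (MeasurableSet.iInter fun j => MeasurableSet.iInter fun _ => (h j).compl)).union
    ((MeasurableSet.const (k = 0)).inter (MeasurableSet.iInter fun j => (h j).compl))

/-- Once the index `k` of the ball is fixed, intersecting with this closed ball only changes the
closed test set; there are countably many `k`. -/
lemma measurableSet_shrink_inter {T : Ω → Set X}
    (hT : ∀ F, IsClosed F → MeasurableSet {ω | (T ω ∩ F).Nonempty}) (n : ℕ) :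
    ∀ F, IsClosed F → MeasurableSet {ω | (shrink (T ω) n ∩ F).Nonempty} := by
  induction n with
  | zero => exact hT
  | succ n ih =>
    intro F hF
    have e : {ω | (shrink (T ω) (n + 1) ∩ F).Nonempty} =
        ⋃ k, {ω | firstHit (shrink (T ω) n) ((1 / 2) ^ n) = k} ∩
          {ω | (shrink (T ω) n ∩ (Metric.closedBall (TopologicalSpace.denseSeq X k) ((1 / 2) ^ n) ∩
            F)).Nonempty} := by
      ext ω
      simp [shrink, inter_assoc]
    rw [e]
    exact MeasurableSet.iUnion fun k =>
      (measurable_firstHit ih _ (measurableSet_singleton k)).inter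
        (ih _ (Metric.isClosed_closedBall.inter hF))

lemma shrink_antitone (E : Set X) : Antitone (shrink E) :=
  antitone_nat_of_succ_le fun _ => inter_subset_left

lemma shrink_nonempty {E : Set X} (hE : E.Nonempty) (n : ℕ) : (shrink E n).Nonempty := by
  induction n with
  | zero => exact hE
  | succ n ih => exact firstHit_spec ih (by positivity)

lemma shrink_empty (n : ℕ) : shrink (∅ : Set X) n = ∅ :=
  subset_empty_iff.1 (shrink_antitone ∅ (Nat.zero_le n))

/-- **Measurable selection** for closed-valued maps such that the inverse images of closed sets are
measurable. -/
theorem exists_measurable_selection [CompleteSpace X] [MeasurableSpace X] [BorelSpace X]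
    {T : Ω → Set X} (hcl : ∀ ω, IsClosed (T ω))
    (hT : ∀ F, IsClosed F → MeasurableSet {ω | (T ω ∩ F).Nonempty}) :
    ∃ f : Ω → X, Measurable f ∧ ∀ ω, (T ω).Nonempty → f ω ∈ T ω := by
  let d : Set X → ℕ → X := fun E n =>
    TopologicalSpace.denseSeq X (firstHit (shrink E n) ((1 / 2) ^ n))
  have hd : ∀ E n x, x ∈ shrink E (n + 1) → dist x (d E n) ≤ (1 / 2) ^ n := fun E n x hx => hx.2
  have hpow : Tendsto (fun n : ℕ => ((1 : ℝ) / 2) ^ n) atTop (𝓝 0) :=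
    tendsto_pow_atTop_nhds_zero_of_lt_one (by norm_num) (by norm_num)
  have hlim : ∀ ω, ∃ y, Tendsto (d (T ω)) atTop (𝓝 y) ∧ ((T ω).Nonempty → y ∈ T ω) := by
    intro ω
    rcases (T ω).eq_empty_or_nonempty with h0 | hne
    · refine ⟨TopologicalSpace.denseSeq X 0, ?_, fun h => absurd h0 h.ne_empty⟩
      have : d (T ω) = fun _ => TopologicalSpace.denseSeq X 0 := by
        funext n
        simp [d, h0, shrink_empty, firstHit]
      rw [this]
      exact tendsto_const_nhds
    -- The shrunk sets are nested, so `e m` is within `(1 / 2) ^ n` of `d (T ω) n` for all `m ≥ n`.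
    -- Hence `e` is a Cauchy sequence in `T ω`, and the centers, which depend measurably on `ω`,
    -- have the same limit.
    · choose e he using fun n => shrink_nonempty hne (n + 1)
      have hed : ∀ n m, n ≤ m → dist (e m) (d (T ω) n) ≤ (1 / 2) ^ n := fun n m hnm =>
        hd _ _ _ (shrink_antitone _ (Nat.succ_le_succ hnm) (he m))
      have hcau : CauchySeq e := by
        refine cauchySeq_of_le_tendsto_0 (fun n => 2 * (1 / 2) ^ n) (fun n m N hn hm => ?_)
          (by simpa using hpow.const_mul 2)
        have := dist_triangle_right (e n) (e m) (d (T ω) N)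
        linarith [hed N n hn, hed N m hm]
      obtain ⟨y, hy⟩ := cauchySeq_tendsto_of_complete hcau
      refine ⟨y, ?_, fun _ => (hcl ω).mem_of_tendsto hy (Eventually.of_forall fun n =>
        shrink_antitone _ (Nat.zero_le _) (he n))⟩
      exact hy.congr_dist (squeeze_zero (fun _ => dist_nonneg) (fun n => hed n n le_rfl) hpow)
  choose f hf hfT using hlim
  refine ⟨f, measurable_of_tendsto_metrizable (f := fun n ω => d (T ω) n) (fun n => ?_)
    (tendsto_pi_nhds.2 hf), hfT⟩
  exact (measurable_from_nat (f := TopologicalSpace.denseSeq X)).comp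
    (measurable_firstHit (measurableSet_shrink_inter hT n) _)

end Selection

/-! ### Attainment and measurability of barycenter points -/

section BarycenterPoints

variable {X : Type*} {K : ℕ}

/-- The infimum of the barycenter functional `y ↦ ∑ i ∈ A, c y (x i)` over the set `F`. -/
noncomputable def infCost (c : X → X → ℝ≥0∞) (A : Finset (Fin K)) (F : Set X) (x : Fin K → X) :
    ℝ≥0∞ :=
  ⨅ y ∈ F, ∑ i ∈ A, c y (x i)

lemma infCost_le (c : X → X → ℝ≥0∞) (A : Finset (Fin K)) {F : Set X} (x : Fin K → X) {y : X}
    (hy : y ∈ F) : infCost c A F x ≤ ∑ i ∈ A, c y (x i) :=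
  iInf₂_le y hy

lemma mem_baryPoints_iff {c : X → X → ℝ≥0∞} {A : Finset (Fin K)} {x : Fin K → X} {y : X} :
    y ∈ baryPoints c A x ↔ infCost c A univ x ≠ ⊤ ∧ ∑ i ∈ A, c y (x i) ≤ infCost c A univ x := by
  simp only [baryPoints, mem_ofPred_eq, infCost, mem_univ, iInf_pos, le_iInf_iff]
  refine and_congr_left fun h => not_congr ⟨fun h' => ?_, fun h' => ?_⟩
  · exact iInf_eq_top.2 fun z => top_le_iff.1 (h' ▸ h z)
  · exact iInf_eq_top.1 h' y

variable [MetricSpace X] {c : X → X → ℝ≥0∞} (hc : IsAdmissibleCost c) {A : Finset (Fin K)}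
  {F : Set X}
include hc

lemma IsAdmissibleCost.lowerSemicontinuous_sum (A : Finset (Fin K)) :
    LowerSemicontinuous fun p : X × (Fin K → X) => ∑ i ∈ A, c p.1 (p.2 i) :=
  _root_.lowerSemicontinuous_sum fun i _ => hc.lsc.comp
    (g := fun p : X × (Fin K → X) => (p.1, p.2 i)) (by fun_prop)

/-- A single label `i₀ ∈ A` gives compactness: its cost is bounded by the whole sum and its data
points converge. Joint lower semicontinuity then passes the bound to the limit. -/
lemma IsAdmissibleCost.exists_subseq_sum (hA : A.Nonempty) (hF : IsClosed F) {R : ℝ≥0∞}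
    (hR : R ≠ ⊤) {x : ℕ → Fin K → X} {a : Fin K → X} (hx : Tendsto x atTop (𝓝 a)) {y : ℕ → X}
    (hyF : ∀ n, y n ∈ F) (hy : ∀ n, ∑ i ∈ A, c (y n) (x n i) ≤ R) :
    ∃ b, (b ∈ F ∧ ∑ i ∈ A, c b (a i) ≤ R) ∧ ∃ φ : ℕ → ℕ, StrictMono φ ∧
      Tendsto (y ∘ φ) atTop (𝓝 b) := by
  obtain ⟨i₀, hi₀⟩ := hA
  have hxi : Tendsto (fun n => x n i₀) atTop (𝓝 (a i₀)) := (continuous_apply i₀).tendsto a |>.comp hx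
  obtain ⟨b, -, φ, hφ, hb, -⟩ := hc.exists_subseq (y := y) (x := fun n => x n i₀) hR
    (Metric.isBounded_range_of_tendsto _ hxi)
    (fun n => (Finset.single_le_sum (f := fun i => c (y n) (x n i)) (fun _ _ => zero_le) hi₀).trans
      (hy n))
  refine ⟨b, ⟨hF.mem_of_tendsto hb (Eventually.of_forall fun n => hyF _), ?_⟩, φ, hφ, hb⟩
  exact ((hc.lowerSemicontinuous_sum A).isClosed_preimage R).mem_of_tendsto
    (hb.prodMk_nhds (hx.comp hφ.tendsto_atTop)) (Eventually.of_forall fun n => hy _)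

lemma IsAdmissibleCost.exists_eq_infCost (hA : A.Nonempty) (hF : IsClosed F) {x : Fin K → X}
    (h : infCost c A F x ≠ ⊤) : ∃ y ∈ F, ∑ i ∈ A, c y (x i) = infCost c A F x := by
  obtain ⟨R, hR, hRt⟩ := exists_between h.lt_top
  have hcpt : IsCompact {y | y ∈ F ∧ ∑ i ∈ A, c y (x i) ≤ R} := IsSeqCompact.isCompact fun y hy =>
    hc.exists_subseq_sum hA hF hRt.ne tendsto_const_nhds (fun n => (hy n).1) (fun n => (hy n).2)
  have hex : ∃ y, y ∈ F ∧ ∑ i ∈ A, c y (x i) ≤ R := by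
    simp only [infCost, iInf_lt_iff] at hR
    obtain ⟨y, hyF, hy⟩ := hR
    exact ⟨y, hyF, hy.le⟩
  have hlsc : LowerSemicontinuous fun y => ∑ i ∈ A, c y (x i) :=
    (hc.lowerSemicontinuous_sum A).comp (g := fun y => (y, x)) (by fun_prop)
  obtain ⟨y, hy, hmin⟩ := (hlsc.lowerSemicontinuousOn _).exists_isMinOn hex hcpt
  refine ⟨y, hy.1, le_antisymm (le_iInf₂ fun z hz => ?_) (infCost_le c A x hy.1)⟩
  rcases le_or_gt (∑ i ∈ A, c z (x i)) R with hzR | hzR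
  · exact isMinOn_iff.1 hmin z ⟨hz, hzR⟩
  · exact hy.2.trans hzR.le

lemma IsAdmissibleCost.baryPoints_nonempty (hA : A.Nonempty) {x : Fin K → X}
    (h : infCost c A univ x ≠ ⊤) : (baryPoints c A x).Nonempty := by
  obtain ⟨y, -, hy⟩ := hc.exists_eq_infCost hA isClosed_univ h
  exact ⟨y, mem_baryPoints_iff.2 ⟨h, hy.le⟩⟩

lemma IsAdmissibleCost.isClosed_baryPoints (A : Finset (Fin K)) (x : Fin K → X) :
    IsClosed (baryPoints c A x) := by
  have hlsc : LowerSemicontinuous fun y => ∑ i ∈ A, c y (x i) :=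
    (hc.lowerSemicontinuous_sum A).comp (g := fun y => (y, x)) (by fun_prop)
  have e : baryPoints c A x = {_y | infCost c A univ x ≠ ⊤} ∩
      {y | ∑ i ∈ A, c y (x i) ≤ infCost c A univ x} := by
    ext y
    exact mem_baryPoints_iff
  rw [e]
  exact isClosed_const.inter (hlsc.isClosed_preimage _)

variable [SecondCountableTopology X] [MeasurableSpace X] [BorelSpace X]

lemma IsAdmissibleCost.measurable_infCost (hA : A.Nonempty) (hF : IsClosed F) :
    Measurable (infCost c A F : (Fin K → X) → ℝ≥0∞) := by
  refine measurable_of_Iic fun R => IsClosed.measurableSet ?_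
  rcases eq_or_ne R ⊤ with rfl | hR
  · simp
  · refine IsSeqClosed.isClosed fun x a hx hxa => ?_
    choose y hyF hy using fun n => hc.exists_eq_infCost hA hF ((hx n).trans_lt hR.lt_top).ne
    obtain ⟨b, ⟨hbF, hb⟩, -⟩ := hc.exists_subseq_sum hA hF hR hxa hyF fun n => (hy n).trans_le (hx n)
    exact (infCost_le c A a hbF).trans hb

/-- Because infima over closed sets are attained when finite, `F` contains a minimizer exactly when
the infimum over `F` is finite and does not exceed the global one. -/
lemma IsAdmissibleCost.measurableSet_baryPoints_inter (hA : A.Nonempty) (hF : IsClosed F) :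
    MeasurableSet {x : Fin K → X | (baryPoints c A x ∩ F).Nonempty} := by
  have e : {x : Fin K → X | (baryPoints c A x ∩ F).Nonempty} =
      {x | infCost c A univ x ≠ ⊤} ∩ {x | infCost c A F x ≤ infCost c A univ x} := by
    ext x
    constructor
    · rintro ⟨y, hy, hyF⟩
      obtain ⟨h1, h2⟩ := mem_baryPoints_iff.1 hy
      exact ⟨h1, (infCost_le c A x hyF).trans h2⟩
    · rintro ⟨h1, h2⟩
      obtain ⟨y, hyF, hy⟩ := hc.exists_eq_infCost hA hF (h2.trans_lt (lt_top_iff_ne_top.2 h1)).ne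
      exact ⟨y, mem_baryPoints_iff.2 ⟨h1, hy.trans_le h2⟩, hyF⟩
  rw [e]
  have hm := hc.measurable_infCost hA (isClosed_univ (X := X))
  exact (hm (measurableSet_singleton ⊤).compl).inter
    (measurableSet_le (hc.measurable_infCost hA hF) hm)

lemma IsAdmissibleCost.exists_measurable_baryPoint [CompleteSpace X] [Nonempty X]
    (hA : A.Nonempty) : ∃ f : (Fin K → X) → X, Measurable f ∧
      ∀ x, (baryPoints c A x).Nonempty → f x ∈ baryPoints c A x :=
  exists_measurable_selection (hc.isClosed_baryPoints A)
    fun _ hF => hc.measurableSet_baryPoints_inter hA hF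

end BarycenterPoints

/-! ### Replacing strata by selected barycenter points -/

section Replacement

/-- This turns optimality of the total objective into equality in every single stratum. -/
lemma le_of_sum_le_of_forall_le {ι : Type*} {s : Finset ι} {f g : ι → ℝ≥0∞} (hgf : ∀ i ∈ s, g i ≤ f i)
    (hsum : ∑ i ∈ s, f i ≤ ∑ i ∈ s, g i) (hf : ∑ i ∈ s, f i ≠ ⊤) {i : ι} (hi : i ∈ s) :
    f i ≤ g i := by
  classical
  rw [← Finset.add_sum_erase s f hi] at hsum hf
  rw [← Finset.add_sum_erase s g hi] at hsum
  have h := hsum.trans (add_le_add (le_refl (g i))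
    (Finset.sum_le_sum fun j hj => hgf j (Finset.mem_of_mem_erase hj)))
  exact (ENNReal.add_le_add_iff_right (ENNReal.add_ne_top.1 hf).2).1 h

variable {X : Type*} [MetricSpace X] [CompleteSpace X] [SecondCountableTopology X]
    [MeasurableSpace X] [BorelSpace X] {K : ℕ} {c : X → X → ℝ≥0∞} {μ : Fin K → Measure X}
    [∀ i, IsFiniteMeasure (μ i)]

/-- Optimal couplings of `ν` with `η i`, `i ∈ A`, are realized by one measure on `X × X ^ K`. -/
lemma IsAdmissibleCost.exists_multicoupling [Nonempty X] (hc : IsAdmissibleCost c)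
    {A : Finset (Fin K)} {ν : Measure X} [IsFiniteMeasure ν] {η : Fin K → Measure X}
    (hη : ∀ i ∈ A, η i ≤ μ i) (hcost : ∑ i ∈ A, transportCost c ν (η i) ≠ ⊤) :
    ∃ γ : Measure (X × (Fin K → X)), γ.fst = ν ∧ (∀ᵐ p ∂γ, p.2 ∈ supportTuples μ A) ∧
      (∀ i ∈ A, γ.map (fun p => p.2 i) = η i) ∧
      ∫⁻ p, ∑ i ∈ A, c p.1 (p.2 i) ∂γ = ∑ i ∈ A, transportCost c ν (η i) := by
  -- Coordinates outside `A` do not enter the cost; they are frozen at a support point `a i` so that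
  -- the tuple lies in `supportTuples μ A`.
  have ha : ∀ i, ∃ a : X, μ i ≠ 0 → a ∈ (μ i).support := fun i => by
    by_cases h0 : μ i = 0
    · exact ⟨Classical.arbitrary X, fun h => absurd h0 h⟩
    · exact (Measure.nonempty_support h0).imp fun a ha _ => ha
  choose a ha using ha
  have hρ : ∀ i, ∃ ρ : Measure (X × X), ρ.fst = ν ∧ (i ∈ A → ρ.snd = η i ∧
      ∫⁻ p, c p.1 p.2 ∂ρ = transportCost c ν (η i)) ∧ (i ∉ A → ρ.snd ≪ Measure.dirac (a i)) := by
    intro i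
    by_cases hi : i ∈ A
    · have := isFiniteMeasure_of_le (μ i) (hη i hi)
      obtain ⟨π, h1, h2, h3⟩ := hc.exists_optimal_coupling ν (η i) (ENNReal.sum_ne_top.1 hcost i hi)
      exact ⟨π, h1, fun _ => ⟨h2, h3⟩, fun h => absurd hi h⟩
    · refine ⟨ν.prod (Measure.dirac (a i)), by simp, fun h => absurd h hi, fun _ => ?_⟩
      rw [Measure.snd, Measure.map_snd_prod]
      exact Measure.smul_absolutelyContinuous
  choose ρ hρ1 hρ2 hρ3 using hρ
  obtain ⟨γ, hγ1, hγ2⟩ := exists_glue ν ρ hρ1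
  have hm : ∀ i, Measurable fun p : X × (Fin K → X) => (p.1, p.2 i) := fun i => by fun_prop
  have hm' : ∀ i, Measurable fun p : X × (Fin K → X) => p.2 i := fun i => by fun_prop
  have hsnd : ∀ i, γ.map (fun p => p.2 i) = (ρ i).snd := fun i => by
    rw [← hγ2 i, Measure.snd, Measure.map_map measurable_snd (hm i)]
    rfl
  refine ⟨γ, hγ1, ?_, fun i hi => (hsnd i).trans (hρ2 i hi).1, ?_⟩
  · have hall : ∀ i, ∀ᵐ p ∂γ, i ∈ A ∨ μ i ≠ 0 → p.2 i ∈ (μ i).support := fun i => by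
      by_cases hi : i ∈ A
      · have h : ∀ᵐ x ∂γ.map (fun p => p.2 i), x ∈ (μ i).support := by
          rw [hsnd, (hρ2 i hi).1]
          exact (Measure.absolutelyContinuous_of_le (hη i hi)).ae_le Measure.support_mem_ae
        filter_upwards [ae_of_ae_map (hm' i).aemeasurable h] with p hp _ using hp
      · have h : ∀ᵐ x ∂γ.map (fun p => p.2 i), x = a i := by
          rw [hsnd]
          refine (hρ3 i hi).ae_le ?_
          rw [ae_dirac_eq]
          rfl
        filter_upwards [ae_of_ae_map (hm' i).aemeasurable h] with p hp h'
        exact hp ▸ ha i (h'.resolve_left hi)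
    exact ae_all_iff.2 hall
  · have hcm : Measurable fun p : X × X => c p.1 p.2 := hc.lsc.measurable
    rw [lintegral_finsetSum (f := fun i (p : X × (Fin K → X)) => c p.1 (p.2 i)) _
      fun i _ => hcm.comp (hm i)]
    refine Finset.sum_congr rfl fun i hi => ?_
    rw [← (hρ2 i hi).2, ← hγ2 i, lintegral_map hcm (hm i)]

/-- The strata of a solution of the stratified problem are concentrated on barycenter points, and
they may be replaced by the images under an arbitrary selection of barycenter points. -/
theorem IsAdmissibleCost.exists_replacement [Nonempty X] (hc : IsAdmissibleCost c)
    {lamA : Finset (Fin K) → Measure X} {μA : Fin K → Finset (Fin K) → Measure X}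
    (h : IsStratSolution c μ lamA μA) {f : Finset (Fin K) → (Fin K → X) → X}
    (hf : IsBarySelection c μ f) :
    ∃ γ : Finset (Fin K) → Measure (X × (Fin K → X)),
      (∀ A ∈ labelSets K, (γ A).fst = lamA A ∧ IsFiniteMeasure (γ A) ∧
        ∀ᵐ p ∂γ A, p.2 ∈ supportTuples μ A ∧ p.1 ∈ baryPoints c A p.2) ∧
      IsStratSolution c μ (fun A => (γ A).map fun p => f A p.2) μA := by
  have hobj := (hc.isOptimalBarycenter_of_isStratSolution h).2
  have hterm := fun A hA => ENNReal.add_ne_top.1 (ENNReal.sum_ne_top.1 hobj A hA)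
  have hex : ∀ A ∈ labelSets K, ∃ γ : Measure (X × (Fin K → X)), γ.fst = lamA A ∧
      (∀ᵐ p ∂γ, p.2 ∈ supportTuples μ A) ∧ (∀ i ∈ A, γ.map (fun p => p.2 i) = μA i A) ∧
      ∫⁻ p, ∑ i ∈ A, c p.1 (p.2 i) ∂γ = ∑ i ∈ A, transportCost c (lamA A) (μA i A) := by
    intro A hA
    have := h.1.1 A hA
    refine hc.exists_multicoupling (fun i hi => ?_) (hterm A hA).2
    rw [← h.1.2 i]
    refine Measure.le_iff'.2 fun s => ?_
    rw [Measure.finsetSum_apply]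
    exact Finset.single_le_sum (f := fun B => μA i B s) (fun _ _ => zero_le)
      (Finset.mem_filter.2 ⟨hA, hi⟩)
  choose! γ hγ1 hγ2 hγ3 hγ4 using hex
  have hfin : ∀ A ∈ labelSets K, IsFiniteMeasure (γ A) := fun A hA => ⟨by
    rw [← Measure.fst_univ, hγ1 A hA]
    exact (hterm A hA).1.lt_top⟩
  have hfm : ∀ A ∈ labelSets K, Measurable fun p : X × (Fin K → X) => f A p.2 := fun A hA =>
    (hf A hA).1.comp measurable_snd
  have hSm : ∀ A : Finset (Fin K), Measurable fun p : X × (Fin K → X) => ∑ i ∈ A, c p.1 (p.2 i) :=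
    fun A => (hc.lowerSemicontinuous_sum A).measurable
  have hmin : ∀ A ∈ labelSets K, ∀ᵐ p ∂γ A,
      ∑ i ∈ A, c (f A p.2) (p.2 i) ≤ infCost c A univ p.2 ∧ infCost c A univ p.2 ≠ ⊤ := by
    intro A hA
    have htop := ae_lt_top (hSm A) (by rw [hγ4 A hA]; exact (hterm A hA).2)
    filter_upwards [htop, hγ2 A hA] with p hp hsupp
    have hne : infCost c A univ p.2 ≠ ⊤ := ((infCost_le c A p.2 (mem_univ p.1)).trans_lt hp).ne
    exact ⟨(mem_baryPoints_iff.1 ((hf A hA).2 _ hsupp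
      (hc.baryPoints_nonempty (Finset.mem_filter.1 hA).2 hne))).2, hne⟩
  have hnew : ∀ A ∈ labelSets K, ∑ i ∈ A, transportCost c ((γ A).map fun p => f A p.2) (μA i A) ≤
      ∫⁻ p, ∑ i ∈ A, c (f A p.2) (p.2 i) ∂γ A := by
    intro A hA
    have hm : ∀ i, Measurable fun p : X × (Fin K → X) => (f A p.2, p.2 i) := fun i =>
      (hfm A hA).prodMk (by fun_prop)
    have hcm : Measurable fun p : X × X => c p.1 p.2 := hc.lsc.measurable
    rw [lintegral_finsetSum (f := fun i (p : X × (Fin K → X)) => c (f A p.2) (p.2 i)) _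
      fun i _ => hcm.comp (hm i)]
    refine Finset.sum_le_sum fun i hi => ?_
    -- This image measure couples the moved stratum with the unchanged `μA i A`.
    have ht := transportCost_le c ((γ A).map fun p => (f A p.2, p.2 i))
    rw [Measure.fst_map_prodMk (by fun_prop), Measure.snd_map_prodMk (hfm A hA), hγ3 A hA i hi,
      lintegral_map hcm (hm i)] at ht
    exact ht
  have hle : ∀ A ∈ labelSets K, ∀ᵐ p ∂γ A,
      ∑ i ∈ A, c (f A p.2) (p.2 i) ≤ ∑ i ∈ A, c p.1 (p.2 i) := fun A hA => by
    filter_upwards [hmin A hA] with p hp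
    exact hp.1.trans (infCost_le c A p.2 (mem_univ p.1))
  have hcostle : ∀ A ∈ labelSets K, ∫⁻ p, ∑ i ∈ A, c (f A p.2) (p.2 i) ∂γ A ≤
      ∑ i ∈ A, transportCost c (lamA A) (μA i A) := fun A hA =>
    (lintegral_mono_ae (hle A hA)).trans_eq (hγ4 A hA)
  have hmass : ∀ A ∈ labelSets K, ((γ A).map fun p => f A p.2) univ = lamA A univ := fun A hA => by
    rw [Measure.map_apply (hfm A hA) MeasurableSet.univ, preimage_univ, ← Measure.fst_univ,
      hγ1 A hA]
  have hfeas : StratFeasible μ (fun A => (γ A).map fun p => f A p.2) μA :=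
    ⟨fun A hA => ⟨by rw [hmass A hA]; exact (hterm A hA).1.lt_top⟩, h.1.2⟩
  have htermle : ∀ A ∈ labelSets K, ((γ A).map fun p => f A p.2) univ +
      ∑ i ∈ A, transportCost c ((γ A).map fun p => f A p.2) (μA i A) ≤
      lamA A univ + ∑ i ∈ A, transportCost c (lamA A) (μA i A) := fun A hA =>
    add_le_add (hmass A hA).le ((hnew A hA).trans (hcostle A hA))
  refine ⟨γ, fun A hA => ⟨hγ1 A hA, hfin A hA, ?_⟩, hfeas, fun lamA' μA' hf' =>
    (Finset.sum_le_sum htermle).trans (h.2 _ _ hf')⟩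
  -- Optimality of the original strata leaves no strict gain: the integrals before and after the
  -- move agree, so the pointwise inequality `hle` is an equality almost everywhere, and `p.1` is
  -- itself a minimizer.
  have heq := le_of_sum_le_of_forall_le htermle (h.2 _ _ hfeas) hobj hA
  rw [hmass A hA, ENNReal.add_le_add_iff_left (hterm A hA).1] at heq
  have hae := ae_eq_of_ae_le_of_lintegral_le (hle A hA)
    (((hcostle A hA).trans_lt (hterm A hA).2.lt_top).ne) (hSm A).aemeasurable
    (((hγ4 A hA).le.trans heq).trans (hnew A hA))
  filter_upwards [hγ2 A hA, hmin A hA, hae] with p hp1 hp2 hp3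
  exact ⟨hp1, mem_baryPoints_iff.2 ⟨hp2.2, hp3 ▸ hp2.1⟩⟩

end Replacement

/-! ### Concentration statements and finitely supported data -/

section Concentration

lemma ConcentratedOn.mono {X : Type*} [MeasurableSpace X] {ν : Measure X} {S T : Set X}
    (h : ConcentratedOn ν S) (hST : S ⊆ T) : ConcentratedOn ν T :=
  measure_mono_null (compl_subset_compl.2 hST) h

lemma concentratedOn_of_isEmpty {X : Type*} [MeasurableSpace X] [IsEmpty X] (ν : Measure X)
    (S : Set X) : ConcentratedOn ν S := by
  rw [ConcentratedOn, Set.eq_empty_of_isEmpty Sᶜ, measure_empty]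

lemma concentratedOn_sum_labelSets {X : Type*} [MeasurableSpace X] {K : ℕ}
    {lamA : Finset (Fin K) → Measure X} {S : Set X}
    (h : ∀ A ∈ labelSets K, ConcentratedOn (lamA A) S) :
    ConcentratedOn (∑ A ∈ labelSets K, lamA A) S := by
  rw [ConcentratedOn, Measure.finsetSum_apply]
  exact Finset.sum_eq_zero h

variable {X : Type*} [MetricSpace X] [CompleteSpace X] [SecondCountableTopology X]
    [MeasurableSpace X] [BorelSpace X] {K : ℕ} {c : X → X → ℝ≥0∞} {μ : Fin K → Measure X}
    [∀ i, IsFiniteMeasure (μ i)]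

theorem IsAdmissibleCost.concentratedOn_baryPointSet (hc : IsAdmissibleCost c)
    {lamA : Finset (Fin K) → Measure X} {μA : Fin K → Finset (Fin K) → Measure X}
    (h : IsStratSolution c μ lamA μA) {A : Finset (Fin K)} (hA : A ∈ labelSets K) :
    ConcentratedOn (lamA A) (baryPointSet c μ A) := by
  rcases isEmpty_or_nonempty X with _ | _
  · exact concentratedOn_of_isEmpty _ _
  have hex : ∀ A ∈ labelSets K, ∃ f : (Fin K → X) → X, Measurable f ∧
      ∀ x, (baryPoints c A x).Nonempty → f x ∈ baryPoints c A x := fun A hA =>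
    hc.exists_measurable_baryPoint (Finset.mem_filter.1 hA).2
  choose! f hf using hex
  obtain ⟨γ, hγ, -⟩ := hc.exists_replacement h (f := f)
    fun A hA => ⟨(hf A hA).1, fun x _ => (hf A hA).2 x⟩
  obtain ⟨h1, h2, h3⟩ := hγ A hA
  rw [← h1]
  refine (ConcentratedOn.image_fst
    (G := {p | p.2 ∈ supportTuples μ A ∧ p.1 ∈ baryPoints c A p.2}) h3).mono ?_
  rintro _ ⟨p, hp, rfl⟩
  exact mem_biUnion hp.1 hp.2

lemma measurableSet_supportTuples {X : Type*} [TopologicalSpace X] [MeasurableSpace X]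
    [OpensMeasurableSpace X] {K : ℕ} (μ : Fin K → Measure X) (A : Finset (Fin K)) :
    MeasurableSet (supportTuples μ A) := by
  have e : supportTuples μ A = ⋂ i, ⋂ (_ : i ∈ A ∨ μ i ≠ 0), (fun x => x i) ⁻¹' (μ i).support := by
    ext x
    simp [supportTuples]
  rw [e]
  exact MeasurableSet.iInter fun i => MeasurableSet.iInter fun _ =>
    measurable_pi_apply i Measure.isClosed_support.measurableSet

theorem IsAdmissibleCost.exists_isOptimalBarycenter_concentratedOn (hc : IsAdmissibleCost c)
    {f : Finset (Fin K) → (Fin K → X) → X} (hf : IsBarySelection c μ f) :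
    ∃ lam : Measure X, IsOptimalBarycenter c μ lam ∧ ConcentratedOn lam (selectedPoints c μ f) := by
  obtain ⟨lam₀, μt₀, h₀, -⟩ := hc.exists_isBarySolution μ
  rcases isEmpty_or_nonempty X with _ | _
  · exact ⟨lam₀, ⟨μt₀, h₀⟩, concentratedOn_of_isEmpty _ _⟩
  obtain ⟨lamA, μA, h, -⟩ := hc.exists_isStratSolution h₀
  obtain ⟨γ, hγ, hsol⟩ := hc.exists_replacement h hf
  refine ⟨_, (hc.isOptimalBarycenter_of_isStratSolution hsol).1,
    concentratedOn_sum_labelSets fun A hA => ?_⟩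
  obtain ⟨-, hfin, h3⟩ := hγ A hA
  have hm : Measurable fun p : X × (Fin K → X) => (f A p.2, p.2) :=
    ((hf A hA).1.comp measurable_snd).prodMk measurable_snd
  -- The image of `f A` need not be Borel, so concentration is shown on the graph, which is Borel,
  -- and then projected.
  have hG : ConcentratedOn ((γ A).map fun p => (f A p.2, p.2))
      {q | q.1 = f A q.2 ∧ q.2 ∈ {x ∈ supportTuples μ A | (baryPoints c A x).Nonempty}} := by
    have h4 : ∀ᵐ p ∂γ A, p.2 ∈ {x ∈ supportTuples μ A | (baryPoints c A x).Nonempty} := by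
      filter_upwards [h3] with p hp using ⟨hp.1, p.1, hp.2⟩
    have hS : MeasurableSet {x ∈ supportTuples μ A | (baryPoints c A x).Nonempty} := by
      have hb := hc.measurableSet_baryPoints_inter (Finset.mem_filter.1 hA).2
        (isClosed_univ (X := X))
      simp only [inter_univ] at hb
      exact (measurableSet_supportTuples μ A).inter hb
    have hmeas := (measurableSet_eq_fun (measurable_fst (α := X))
      ((hf A hA).1.comp measurable_snd)).inter (measurable_snd (α := X) hS)
    refine (Measure.map_apply hm hmeas.compl).trans (measure_mono_null (fun p hp => ?_) h4)
    exact fun hp' => hp ⟨rfl, hp'⟩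
  have := hG.image_fst
  rw [Measure.fst_map_prodMk measurable_snd] at this
  refine this.mono ?_
  rintro _ ⟨q, ⟨hq1, hq2⟩, rfl⟩
  exact mem_biUnion hA ⟨q.2, hq2, hq1.symm⟩

omit [∀ i, IsFiniteMeasure (μ i)] in
open Classical in
-- Since `baryPoints c A x` depends only on the coordinates in `A`, the others may be reset to `x₀`;
-- at most `∏ i ∈ A, (E i).card` tuples then matter.
lemma exists_finite_selection [Nonempty X] (c : X → X → ℝ≥0∞) {E : Fin K → Finset X}
    (hE : ∀ i, ConcentratedOn (μ i) (E i : Set X)) :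
    ∃ (f : Finset (Fin K) → (Fin K → X) → X) (F : Finset X), IsBarySelection c μ f ∧
      selectedPoints c μ f ⊆ F ∧ F.card ≤ ∑ A ∈ labelSets K, ∏ i ∈ A, (E i).card := by
  have hsupp : ∀ i, (μ i).support ⊆ E i := fun i =>
    Measure.support_subset_of_isClosed (E i).finite_toSet.isClosed (hE i)
  let x₀ : X := Classical.arbitrary X
  let r : Finset (Fin K) → (Fin K → X) → Fin K → X := fun A x i => if i ∈ A then x i else x₀
  let P : Finset (Fin K) → Finset (Fin K → X) := fun A =>
    Fintype.piFinset fun i => if i ∈ A then E i else {x₀}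
  let g : Finset (Fin K) → (Fin K → X) → X := fun A z =>
    if h : (baryPoints c A z).Nonempty then h.some else x₀
  -- Being constant off the finite set `P A` makes this arbitrary choice of minimizers Borel.
  let g' : Finset (Fin K) → (Fin K → X) → X := fun A z => if z ∈ P A then g A z else x₀
  have hr : ∀ A, Measurable (r A) := fun A => measurable_pi_lambda _ fun i => by
    by_cases hi : i ∈ A
    · simpa [r, hi] using measurable_pi_apply i
    · simp [r, hi]
  have hg' : ∀ A, Measurable (g' A) := fun A => by
    refine (measurable_const (a := x₀)).measurable_of_countable_ne
      ((P A).finite_toSet.countable.mono fun z hz => ?_)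
    by_contra hzP
    exact hz (if_neg hzP).symm
  have hbr : ∀ A x, baryPoints c A (r A x) = baryPoints c A x := fun A x => by
    have : ∀ y, ∑ i ∈ A, c y (r A x i) = ∑ i ∈ A, c y (x i) := fun y =>
      Finset.sum_congr rfl fun i hi => by simp [r, hi]
    simp only [baryPoints, this]
  have hrP : ∀ A, ∀ x ∈ supportTuples μ A, r A x ∈ P A := fun A x hx => by
    refine Fintype.mem_piFinset.2 fun i => ?_
    by_cases hi : i ∈ A
    · simpa [r, hi] using hsupp i (hx i (Or.inl hi))
    · simp [r, hi]
  refine ⟨fun A x => g' A (r A x), (labelSets K).biUnion fun A => (P A).image (g A),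
    fun A hA => ⟨(hg' A).comp (hr A), fun x hx hne => ?_⟩, ?_, ?_⟩
  · rw [← hbr] at hne ⊢
    simp only [g', hrP A x hx, if_true, g, hne, dif_pos]
    exact hne.some_mem
  · refine iUnion₂_subset fun A hA => ?_
    rintro _ ⟨x, ⟨hx, -⟩, rfl⟩
    simp only [g', hrP A x hx, if_true]
    exact Finset.mem_coe.2 (Finset.mem_biUnion.2
      ⟨A, hA, Finset.mem_image_of_mem _ (hrP A x hx)⟩)
  · refine Finset.card_biUnion_le.trans (Finset.sum_le_sum fun A _ => ?_)
    refine Finset.card_image_le.trans_eq ?_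
    simp [P, Fintype.card_piFinset, apply_ite Finset.card, Finset.prod_ite_mem]

lemma sum_prod_card_le {K : ℕ} {n : Fin K → ℕ} (hn : ∀ i, 1 ≤ n i) :
    ∑ A ∈ labelSets K, ∏ i ∈ A, n i ≤ 2 ^ K * ∏ i, n i := by
  have h : ∀ A ∈ labelSets K, ∏ i ∈ A, n i ≤ ∏ i, n i := fun A _ =>
    Finset.prod_le_prod_of_subset_of_one_le' (Finset.subset_univ A) fun i _ _ => hn i
  refine (Finset.sum_le_card_nsmul _ _ _ h).trans ?_
  rw [smul_eq_mul]
  refine Nat.mul_le_mul_right _ ((Finset.card_le_univ _).trans ?_)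
  simp

end Concentration
end GenBary

/-! ### The main theorem -/

theorem mainTheorem5 {X : Type*} [MetricSpace X] [CompleteSpace X] [SecondCountableTopology X]
    [MeasurableSpace X] [BorelSpace X] {K : ℕ} (c : X → X → ℝ≥0∞)
    (hc : GenBary.IsAdmissibleCost c) (μ : Fin K → Measure X) [∀ i, IsFiniteMeasure (μ i)] :
    -- optimal generalized barycenters exist
    (∃ lam : Measure X, GenBary.IsOptimalBarycenter c μ lam) ∧
    -- each of them has a decomposition that is optimal for the stratified problem
    (∀ lam : Measure X, GenBary.IsOptimalBarycenter c μ lam →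
      ∃ (lamA : Finset (Fin K) → Measure X) (μA : Fin K → Finset (Fin K) → Measure X),
        GenBary.IsStratSolution c μ lamA μA ∧ ∑ A ∈ GenBary.labelSets K, lamA A = lam) ∧
    -- any such decomposition, the barycenter and the attacked measures sit on barycenter points
    (∀ (lam : Measure X) (lamA : Finset (Fin K) → Measure X)
        (μA : Fin K → Finset (Fin K) → Measure X),
      GenBary.IsOptimalBarycenter c μ lam → GenBary.IsStratSolution c μ lamA μA →
      ∑ A ∈ GenBary.labelSets K, lamA A = lam →
        (∀ A ∈ GenBary.labelSets K,
          GenBary.ConcentratedOn (lamA A) (GenBary.baryPointSet c μ A)) ∧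
        GenBary.ConcentratedOn lam (GenBary.allBaryPoints c μ) ∧
        ∀ μt : Fin K → Measure X, GenBary.IsBarySolution c μ lam μt →
          ∀ i, GenBary.ConcentratedOn (μt i) (GenBary.allBaryPoints c μ)) ∧
    -- for any selection there is an optimal barycenter on the selected points
    (∀ f : Finset (Fin K) → (Fin K → X) → X, GenBary.IsBarySelection c μ f →
      ∃ lam : Measure X, GenBary.IsOptimalBarycenter c μ lam ∧
        GenBary.ConcentratedOn lam (GenBary.selectedPoints c μ f)) ∧
    -- finitely supported data
    (∀ E : Fin K → Finset X, (∀ i, GenBary.ConcentratedOn (μ i) (E i : Set X)) →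
      (∃ (lam : Measure X) (F : Finset X), GenBary.IsOptimalBarycenter c μ lam ∧
        GenBary.ConcentratedOn lam (F : Set X) ∧
        F.card ≤ ∑ A ∈ GenBary.labelSets K, ∏ i ∈ A, (E i).card) ∧
      ((∀ i, (E i).Nonempty) →
        ∑ A ∈ GenBary.labelSets K, ∏ i ∈ A, (E i).card ≤ 2 ^ K * ∏ i, (E i).card)) := by
  have hopt : ∀ lam, GenBary.IsOptimalBarycenter c μ lam →
      ∃ (lamA : Finset (Fin K) → Measure X) (μA : Fin K → Finset (Fin K) → Measure X),
        GenBary.IsStratSolution c μ lamA μA ∧ ∑ A ∈ GenBary.labelSets K, lamA A = lam := by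
    rintro lam ⟨μt, h⟩
    obtain ⟨lamA, μA, hs, hsum, -⟩ := hc.exists_isStratSolution h
    exact ⟨lamA, μA, hs, hsum⟩
  obtain ⟨lam₀, μt₀, h₀, -⟩ := hc.exists_isBarySolution μ
  refine ⟨⟨lam₀, μt₀, h₀⟩, hopt, ?_, ?_, fun E hE => ⟨?_, fun hne => ?_⟩⟩
  · rintro lam lamA μA - hs rfl
    have hA := fun A hA => hc.concentratedOn_baryPointSet hs (A := A) hA
    have hlam := GenBary.concentratedOn_sum_labelSets fun A h =>
      (hA A h).mono (subset_biUnion_of_mem (u := fun A => GenBary.baryPointSet c μ A) h)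
    exact ⟨hA, hlam, fun μt hμt i => le_antisymm ((hμt.1.2 i _).trans_eq hlam) zero_le⟩
  · exact fun f hf => hc.exists_isOptimalBarycenter_concentratedOn hf
  · rcases isEmpty_or_nonempty X with _ | _
    · exact ⟨lam₀, ∅, ⟨μt₀, h₀⟩, GenBary.concentratedOn_of_isEmpty _ _, by simp⟩
    obtain ⟨f, F, hf, hF, hcard⟩ := GenBary.exists_finite_selection c hE
    obtain ⟨lam, hlam, hconc⟩ := hc.exists_isOptimalBarycenter_concentratedOn hf
    exact ⟨lam, F, hlam, hconc.mono hF, hcard⟩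
  · exact GenBary.sum_prod_card_le fun i => (hne i).card_pos
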